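/- **Definitions.** A *strict physical duoidal category* $(\mathbb V,\triangleleft,\otimes,N)$ is a category with a strict monoidal structure $(\triangleleft,N)$ and a strict symmetric monoidal structure $(\otimes,N)$ sharing the same unit, with symmetries $\jmath_{X,Y}: X\otimes Y\to Y\otimes X$ and natural distributors $d_{X,Y,Z,W}:(X\triangleleft Z)\otimes(Y\triangleleft W)\to(X\otimes Y)\triangleleft(Z\otimes W)$, which is coherent: any two formal composites of structure maps (built from identities, composition, $\triangleleft$, $\otimes$, $d$, $\jmath$ and strict associativity and unitality) with the same formal source and the same formal target, in which no variable is repeated, are equal for every assignment of objects to the variables. A *strict physical duoidal functor* is a functor that strictly preserves $N$, $\triangleleft$, $\otimes$, $d$ and $\jmath$. These form the category $\mathbf{PhyDuo}$, and $\mathrm{Obj}:\mathbf{PhyDuo}\to\mathbf{Set}$ takes the set of objects. *Duoidal expressions* over a set $A$ are built inductively as: the empty expression $N$; a singleton $a$ for $a\in A$; a sequence $E_1\triangleleft\cdots\triangleleft E_n$ ($n\ge 2$) of expressions that are neither empty nor sequences; a tensoring $E_1\otimes\cdots\otimes E_n$ ($n\ge 2$) of expressions that are neither empty nor tensorings. They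 are sequenced and tensored up to strict associativity and unitality. Each expression has a corresponding finite *zetless poset* (a poset with no full subposet $x\to u\leftarrow y\to v$) labelled by $A$: the empty poset for $N$, the one-point poset labelled $a$ for $a$, the disjoint union with every element of each earlier component placed below every element of each later one for a sequence, and the disjoint union for a tensoring. The category of *zetless maps* $\mathrm{Zetless}(A)$ has the duoidal expressions over $A$ as objects; its morphisms $E\to F$ are the label-preserving, order-preserving bijections from the zetless poset of $E$ to that of $F$ (type-preserving, bijective-on-objects inclusions). With the sequencing and tensoring of expressions and of inclusions, and the evident symmetries and distributors, it is a strict physical duoidal category. A function $\varphi:A\to B$ induces a strict physical duoidal functor $\mathrm{Zetless}(A)\to\mathrm{Zetless}(B)$ that changes the labels of expressions and transports the inclusions; this defines a functor $\mathrm{Zetless}:\mathbf{Set}\to\mathbf{PhyDuo}$. **Theorem.** $\mathrm{Zetless}(A)$ is the free strict physical duoidal category on the set $A$: for every strict physical duoidal category $\mathbb V$ and every function $f:A\to\mathrm{Obj}(\mathbb V)$ there is a unique strict physical duoidal functor $F:\mathrm{Zetless}(A)\to\mathbb V$ with $F(a)=f(a)$ for every singleton expression $a$, $a\in A$. Equivalently,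 the functor $\mathrm{Zetless}:\mathbf{Set}\to\mathbf{PhyDuo}$ is left adjoint to $\mathrm{Obj}:\mathbf{PhyDuo}\to\mathbf{Set}$, with unit $A\to\mathrm{Obj}(\mathrm{Zetless}(A))$ sending each $a\in A$ to the singleton expression $a$. -/

import Mathlib

open CategoryTheory

universe v u w

namespace PhysicalDuoidal

/-! ## Strict physical duoidal categories -/

/-- A strict monoidal structure with unit `I` on a category: associativity and unitality hold on
the nose, on objects and on morphisms. -/
structure StrictMonoidal (V : Type u) [Category.{v} V] (I : V) where
  obj : V → V → V
  map : ∀ {X X' Y Y' : V}, (X ⟶ X') → (Y ⟶ Y') → (obj X Y ⟶ obj X' Y')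
  map_id : ∀ X Y : V, map (𝟙 X) (𝟙 Y) = 𝟙 (obj X Y)
  map_comp : ∀ {X X' X'' Y Y' Y'' : V} (f : X ⟶ X') (f' : X' ⟶ X'') (g : Y ⟶ Y') (g' : Y' ⟶ Y''),
    map (f ≫ f') (g ≫ g') = map f g ≫ map f' g'
  assoc : ∀ X Y Z : V, obj (obj X Y) Z = obj X (obj Y Z)
  unit_left : ∀ X : V, obj I X = X
  unit_right : ∀ X : V, obj X I = X
  map_assoc : ∀ {X X' Y Y' Z Z' : V} (f : X ⟶ X') (g : Y ⟶ Y') (h : Z ⟶ Z'),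
    HEq (map (map f g) h) (map f (map g h))
  map_unit_left : ∀ {X X' : V} (f : X ⟶ X'), HEq (map (𝟙 I) f) f
  map_unit_right : ∀ {X X' : V} (f : X ⟶ X'), HEq (map f (𝟙 I)) f

/-- The structure carried by a strict physical duoidal category: a strict monoidal structure `seq`
(written `◁`) and a strict symmetric monoidal structure `par` (written `⊗`, with symmetry `sym`)
sharing the same unit `N`, and natural distributors `d`. -/
structure DuoidalStructure (V : Type u) [Category.{v} V] where
  N : V
  seq : StrictMonoidal V N
  par : StrictMonoidal V N
  /-- `X ⊗ Y ⟶ Y ⊗ X` -/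
  sym : ∀ X Y : V, par.obj X Y ⟶ par.obj Y X
  sym_natural : ∀ {X X' Y Y' : V} (f : X ⟶ X') (g : Y ⟶ Y'),
    par.map f g ≫ sym X' Y' = sym X Y ≫ par.map g f
  sym_sym : ∀ X Y : V, sym X Y ≫ sym Y X = 𝟙 (par.obj X Y)
  hexagon : ∀ X Y Z : V, HEq (sym (par.obj X Y) Z)
    (par.map (𝟙 X) (sym Y Z) ≫ eqToHom (par.assoc X Z Y).symm ≫ par.map (sym X Z) (𝟙 Y))
  /-- `(X ◁ Z) ⊗ (Y ◁ W) ⟶ (X ⊗ Y) ◁ (Z ⊗ W)` -/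
  d : ∀ X Y Z W : V,
    par.obj (seq.obj X Z) (seq.obj Y W) ⟶ seq.obj (par.obj X Y) (par.obj Z W)
  d_natural : ∀ {X X' Y Y' Z Z' W W' : V}
    (f : X ⟶ X') (g : Y ⟶ Y') (h : Z ⟶ Z') (k : W ⟶ W'),
    par.map (seq.map f h) (seq.map g k) ≫ d X' Y' Z' W' =
      d X Y Z W ≫ seq.map (par.map f g) (par.map h k)

/-- Formal binary expressions in a unit, two binary operations and variables from `A`. -/
inductive Term (A : Type u) : Type u
  | unit : Term A
  | atom : A → Term A
  | seq : Term A → Term A → Term A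
  | par : Term A → Term A → Term A

namespace Term

variable {A : Type u} {B : Type w}

/-- The variables of a formal expression, from left to right. -/
def atoms : Term A → List A
  | unit => []
  | atom a => [a]
  | seq s t => s.atoms ++ t.atoms
  | par s t => s.atoms ++ t.atoms

/-- Renaming of variables. -/
def rename (f : A → B) : Term A → Term B
  | unit => unit
  | atom a => atom (f a)
  | seq s t => seq (s.rename f) (t.rename f)
  | par s t => par (s.rename f) (t.rename f)

end Term

/-- The elementary pairs of formal expressions that strictness identifies. -/
inductive StrictPair {A : Type u} : Term A → Term A → Prop
  | seq_assoc (s t r : Term A) : StrictPair ((s.seq t).seq r) (s.seq (t.seq r))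
  | seq_unit_left (s : Term A) : StrictPair (Term.unit.seq s) s
  | seq_unit_right (s : Term A) : StrictPair (s.seq Term.unit) s
  | par_assoc (s t r : Term A) : StrictPair ((s.par t).par r) (s.par (t.par r))
  | par_unit_left (s : Term A) : StrictPair (Term.unit.par s) s
  | par_unit_right (s : Term A) : StrictPair (s.par Term.unit) s

/-- Formal structure maps: the morphisms built from identities, composition, the two tensors, the
distributors and the symmetries. Between two expressions that are identified by strictness there
are formal maps `strict` and `strictInv`, which will denote identities. -/
inductive FormalMap {A : Type u} : Term A → Term A → Type u
  | id (s : Term A) : FormalMap s s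
  | comp {s t r : Term A} : FormalMap s t → FormalMap t r → FormalMap s r
  | seq {s s' t t' : Term A} : FormalMap s s' → FormalMap t t' → FormalMap (s.seq t) (s'.seq t')
  | par {s s' t t' : Term A} : FormalMap s s' → FormalMap t t' → FormalMap (s.par t) (s'.par t')
  | d (x y z w : Term A) :
      FormalMap ((x.seq z).par (y.seq w)) ((x.par y).seq (z.par w))
  | sym (x y : Term A) : FormalMap (x.par y) (y.par x)
  | strict {s t : Term A} : StrictPair s t → FormalMap s t
  | strictInv {s t : Term A} : StrictPair s t → FormalMap t s

namespace DuoidalStructure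

variable {V : Type u} [Category.{v} V] (D : DuoidalStructure V) {A : Type w}

/-- The value of a formal expression under an assignment of objects to its variables. -/
def eval (ρ : A → V) : Term A → V
  | Term.unit => D.N
  | Term.atom a => ρ a
  | Term.seq s t => D.seq.obj (eval ρ s) (eval ρ t)
  | Term.par s t => D.par.obj (eval ρ s) (eval ρ t)

theorem eval_strict (ρ : A → V) {s t : Term A} (h : StrictPair s t) :
    D.eval ρ s = D.eval ρ t := by
  cases h with
  | seq_assoc => exact D.seq.assoc _ _ _
  | seq_unit_left => exact D.seq.unit_left _
  | seq_unit_right => exact D.seq.unit_right _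
  | par_assoc => exact D.par.assoc _ _ _
  | par_unit_left => exact D.par.unit_left _
  | par_unit_right => exact D.par.unit_right _

/-- The value of a formal structure map. -/
def evalMap (ρ : A → V) : ∀ {s t : Term A}, FormalMap s t → (D.eval ρ s ⟶ D.eval ρ t)
  | _, _, .id s => 𝟙 (D.eval ρ s)
  | _, _, .comp f g => evalMap ρ f ≫ evalMap ρ g
  | _, _, .seq f g => D.seq.map (evalMap ρ f) (evalMap ρ g)
  | _, _, .par f g => D.par.map (evalMap ρ f) (evalMap ρ g)
  | _, _, .d x y z w => D.d (D.eval ρ x) (D.eval ρ y) (D.eval ρ z) (D.eval ρ w)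
  | _, _, .sym x y => D.sym (D.eval ρ x) (D.eval ρ y)
  | _, _, .strict h => eqToHom (D.eval_strict ρ h)
  | _, _, .strictInv h => eqToHom (D.eval_strict ρ h).symm

/-- Coherence: every formally distinctly typed equation between structure maps holds, that is, any
two formal structure maps with the same source and the same target, in which no variable is
repeated, have the same value under every assignment of objects to the variables. -/
def Coherent : Prop :=
  ∀ (s t : Term ℕ), s.atoms.Nodup → ∀ (f g : FormalMap s t) (ρ : ℕ → V),
    D.evalMap ρ f = D.evalMap ρ g

end DuoidalStructure

/-- Strict physical duoidal categories. -/
structure PhyDuo : Type (max (u + 1) (v + 1)) where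
  carrier : Type u
  [category : Category.{v} carrier]
  str : DuoidalStructure carrier
  coherent : str.Coherent

namespace PhyDuo

instance (V : PhyDuo.{v, u}) : Category.{v} V.carrier := V.category

/-- Strict physical duoidal functors: functors that are strict monoidal for both structures and
strictly preserve the distributors and the symmetries. -/
structure Hom (V W : PhyDuo.{v, u}) where
  functor : V.carrier ⥤ W.carrier
  obj_N : functor.obj V.str.N = W.str.N
  obj_seq : ∀ X Y, functor.obj (V.str.seq.obj X Y) = W.str.seq.obj (functor.obj X) (functor.obj Y)
  obj_par : ∀ X Y, functor.obj (V.str.par.obj X Y) = W.str.par.obj (functor.obj X) (functor.obj Y)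
  map_seq : ∀ {X X' Y Y' : V.carrier} (f : X ⟶ X') (g : Y ⟶ Y'),
    HEq (functor.map (V.str.seq.map f g)) (W.str.seq.map (functor.map f) (functor.map g))
  map_par : ∀ {X X' Y Y' : V.carrier} (f : X ⟶ X') (g : Y ⟶ Y'),
    HEq (functor.map (V.str.par.map f g)) (W.str.par.map (functor.map f) (functor.map g))
  map_sym : ∀ X Y : V.carrier,
    HEq (functor.map (V.str.sym X Y)) (W.str.sym (functor.obj X) (functor.obj Y))
  map_d : ∀ X Y Z W' : V.carrier, HEq (functor.map (V.str.d X Y Z W'))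
    (W.str.d (functor.obj X) (functor.obj Y) (functor.obj Z) (functor.obj W'))

@[ext]
theorem Hom.ext {V W : PhyDuo.{v, u}} {F G : Hom V W} (h : F.functor = G.functor) : F = G := by
  cases F; cases G; cases h; rfl

theorem map_heq {C : Type u} {D : Type u} [Category.{v} C] [Category.{v} D] (F : C ⥤ D)
    {X Y X' Y' : C} (hX : X = X') (hY : Y = Y') {f : X ⟶ Y} {g : X' ⟶ Y'} (h : HEq f g) :
    HEq (F.map f) (F.map g) := by
  subst hX hY; cases h; rfl

/-- The identity functor. -/
def Hom.id (V : PhyDuo.{v, u}) : Hom V V where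
  functor := 𝟭 _
  obj_N := rfl
  obj_seq _ _ := rfl
  obj_par _ _ := rfl
  map_seq _ _ := HEq.rfl
  map_par _ _ := HEq.rfl
  map_sym _ _ := HEq.rfl
  map_d _ _ _ _ := HEq.rfl

/-- Composition of functors. -/
def Hom.comp {U V W : PhyDuo.{v, u}} (F : Hom U V) (G : Hom V W) : Hom U W where
  functor := F.functor ⋙ G.functor
  obj_N := (congrArg G.functor.obj F.obj_N).trans G.obj_N
  obj_seq X Y := (congrArg G.functor.obj (F.obj_seq X Y)).trans (G.obj_seq _ _)
  obj_par X Y := (congrArg G.functor.obj (F.obj_par X Y)).trans (G.obj_par _ _)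
  map_seq f g := (map_heq G.functor (F.obj_seq _ _) (F.obj_seq _ _) (F.map_seq f g)).trans
    (G.map_seq _ _)
  map_par f g := (map_heq G.functor (F.obj_par _ _) (F.obj_par _ _) (F.map_par f g)).trans
    (G.map_par _ _)
  map_sym X Y := (map_heq G.functor (F.obj_par _ _) (F.obj_par _ _) (F.map_sym X Y)).trans
    (G.map_sym _ _)
  map_d X Y Z W' := (map_heq G.functor
    ((F.obj_par _ _).trans (congrArg₂ _ (F.obj_seq _ _) (F.obj_seq _ _)))
    ((F.obj_seq _ _).trans (congrArg₂ _ (F.obj_par _ _) (F.obj_par _ _)))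
    (F.map_d X Y Z W')).trans (G.map_d _ _ _ _)

instance : Category PhyDuo.{v, u} where
  Hom := Hom
  id := Hom.id
  comp := Hom.comp
  id_comp _ := rfl
  comp_id _ := rfl
  assoc _ _ _ := rfl

/-- The functor taking a strict physical duoidal category to its set of objects. -/
def Obj : PhyDuo.{v, u} ⥤ Type u where
  obj V := V.carrier
  map F := TypeCat.ofHom F.functor.obj
  map_id _ := rfl
  map_comp _ _ := rfl

end PhyDuo

/-! ## Duoidal expressions -/

namespace Term

variable {A : Type u} {B : Type w}

/-- Being a sequence. -/
def IsSeq : Term A → Prop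
  | seq _ _ => True
  | _ => False

/-- Being a tensoring. -/
def IsPar : Term A → Prop
  | par _ _ => True
  | _ => False

/-- Reduced terms. A sequence `E₁ ◁ ⋯ ◁ Eₙ` with `n ≥ 2`, each `Eᵢ` neither empty nor a sequence, is
represented by the right-bracketed term `E₁ ◁ (E₂ ◁ (⋯ ◁ Eₙ))`; similarly for tensorings. -/
def Reduced : Term A → Prop
  | unit => True
  | atom _ => True
  | seq s t => s.Reduced ∧ t.Reduced ∧ s ≠ unit ∧ t ≠ unit ∧ ¬ s.IsSeq
  | par s t => s.Reduced ∧ t.Reduced ∧ s ≠ unit ∧ t ≠ unit ∧ ¬ s.IsPar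

/-- Sequencing followed by reduction by associativity and unitality. -/
def seqRed : Term A → Term A → Term A
  | unit, t => t
  | s, unit => s
  | seq s s', t => seq s (seqRed s' t)
  | s, t => seq s t

/-- Tensoring followed by reduction by associativity and unitality. -/
def parRed : Term A → Term A → Term A
  | unit, t => t
  | s, unit => s
  | par s s', t => par s (parRed s' t)
  | s, t => par s t

@[simp] theorem seqRed_unit_left (t : Term A) : seqRed unit t = t := by
  cases t <;> rfl

@[simp] theorem seqRed_unit_right (t : Term A) : seqRed t unit = t := by
  cases t <;> rfl

@[simp] theorem parRed_unit_left (t : Term A) : parRed unit t = t := by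
  cases t <;> rfl

@[simp] theorem parRed_unit_right (t : Term A) : parRed t unit = t := by
  cases t <;> rfl

theorem seqRed_seq (s s' : Term A) {t : Term A} (h : t ≠ unit) :
    seqRed (seq s s') t = seq s (seqRed s' t) := by
  cases t <;> first | rfl | exact absurd rfl h

theorem parRed_par (s s' : Term A) {t : Term A} (h : t ≠ unit) :
    parRed (par s s') t = par s (parRed s' t) := by
  cases t <;> first | rfl | exact absurd rfl h

theorem seqRed_of_not {s t : Term A} (hs : s ≠ unit) (hs' : ¬ s.IsSeq) (h : t ≠ unit) :
    seqRed s t = seq s t := by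
  cases s <;> cases t <;> first | rfl | exact absurd rfl h | exact absurd rfl hs
                                | exact absurd trivial hs'

theorem parRed_of_not {s t : Term A} (hs : s ≠ unit) (hs' : ¬ s.IsPar) (h : t ≠ unit) :
    parRed s t = par s t := by
  cases s <;> cases t <;> first | rfl | exact absurd rfl h | exact absurd rfl hs
                                | exact absurd trivial hs'

/-- Case analysis along the reduction of a sequence. -/
theorem seqRed_induction {P : Term A → Term A → Term A → Prop}
    (h1 : ∀ t, P unit t t) (h2 : ∀ s, P s unit s)
    (h3 : ∀ s s' t, t ≠ unit → P s' t (seqRed s' t) → P (seq s s') t (seq s (seqRed s' t)))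
    (h4 : ∀ s t, s ≠ unit → ¬ s.IsSeq → t ≠ unit → P s t (seq s t)) (s t : Term A) :
    P s t (seqRed s t) := by
  by_cases ht : t = unit
  · subst ht; rw [seqRed_unit_right]; exact h2 s
  induction s with
  | unit => rw [seqRed_unit_left]; exact h1 t
  | atom a => rw [seqRed_of_not (by simp) (by simp [IsSeq]) ht]; exact h4 _ _ (by simp) (by simp [IsSeq]) ht
  | par a b => rw [seqRed_of_not (by simp) (by simp [IsSeq]) ht]; exact h4 _ _ (by simp) (by simp [IsSeq]) ht
  | seq a b _ ihb => rw [seqRed_seq _ _ ht]; exact h3 _ _ _ ht ihb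

/-- Case analysis along the reduction of a tensoring. -/
theorem parRed_induction {P : Term A → Term A → Term A → Prop}
    (h1 : ∀ t, P unit t t) (h2 : ∀ s, P s unit s)
    (h3 : ∀ s s' t, t ≠ unit → P s' t (parRed s' t) → P (par s s') t (par s (parRed s' t)))
    (h4 : ∀ s t, s ≠ unit → ¬ s.IsPar → t ≠ unit → P s t (par s t)) (s t : Term A) :
    P s t (parRed s t) := by
  by_cases ht : t = unit
  · subst ht; rw [parRed_unit_right]; exact h2 s
  induction s with
  | unit => rw [parRed_unit_left]; exact h1 t
  | atom a => rw [parRed_of_not (by simp) (by simp [IsPar]) ht]; exact h4 _ _ (by simp) (by simp [IsPar]) ht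
  | seq a b => rw [parRed_of_not (by simp) (by simp [IsPar]) ht]; exact h4 _ _ (by simp) (by simp [IsPar]) ht
  | par a b _ ihb => rw [parRed_par _ _ ht]; exact h3 _ _ _ ht ihb

theorem seqRed_ne_unit (s t : Term A) : t ≠ unit → seqRed s t ≠ unit := by
  refine seqRed_induction (P := fun s t r => t ≠ unit → r ≠ unit) ?_ ?_ ?_ ?_ s t <;> simp

theorem parRed_ne_unit (s t : Term A) : t ≠ unit → parRed s t ≠ unit := by
  refine parRed_induction (P := fun s t r => t ≠ unit → r ≠ unit) ?_ ?_ ?_ ?_ s t <;> simp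

theorem seqRed_reduced (s t : Term A) : s.Reduced → t.Reduced → (seqRed s t).Reduced := by
  refine seqRed_induction (P := fun s t r => s.Reduced → t.Reduced → r.Reduced) ?_ ?_ ?_ ?_ s t
  · intro t _ h; exact h
  · intro s h _; exact h
  · intro s s' t ht ih h h'
    exact ⟨h.1, ih h.2.1 h', h.2.2.1, seqRed_ne_unit _ _ ht, h.2.2.2.2⟩
  · intro s t hs hs' ht h h'
    exact ⟨h, h', hs, ht, hs'⟩

theorem parRed_reduced (s t : Term A) : s.Reduced → t.Reduced → (parRed s t).Reduced := by
  refine parRed_induction (P := fun s t r => s.Reduced → t.Reduced → r.Reduced) ?_ ?_ ?_ ?_ s t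
  · intro t _ h; exact h
  · intro s h _; exact h
  · intro s s' t ht ih h h'
    exact ⟨h.1, ih h.2.1 h', h.2.2.1, parRed_ne_unit _ _ ht, h.2.2.2.2⟩
  · intro s t hs hs' ht h h'
    exact ⟨h, h', hs, ht, hs'⟩

theorem seqRed_assoc (s t r : Term A) :
    seqRed (seqRed s t) r = seqRed s (seqRed t r) := by
  by_cases hr : r = unit
  · subst hr; simp
  refine seqRed_induction (P := fun s t q => seqRed q r = seqRed s (seqRed t r)) ?_ ?_ ?_ ?_ s t
  · simp
  · simp
  · intro s s' t ht ih
    rw [seqRed_seq _ _ hr, seqRed_seq _ _ (seqRed_ne_unit _ _ hr), ih]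
  · intro s t hs hs' ht
    rw [seqRed_seq _ _ hr, seqRed_of_not hs hs' (seqRed_ne_unit _ _ hr)]

theorem parRed_assoc (s t r : Term A) :
    parRed (parRed s t) r = parRed s (parRed t r) := by
  by_cases hr : r = unit
  · subst hr; simp
  refine parRed_induction (P := fun s t q => parRed q r = parRed s (parRed t r)) ?_ ?_ ?_ ?_ s t
  · simp
  · simp
  · intro s s' t ht ih
    rw [parRed_par _ _ hr, parRed_par _ _ (parRed_ne_unit _ _ hr), ih]
  · intro s t hs hs' ht
    rw [parRed_par _ _ hr, parRed_of_not hs hs' (parRed_ne_unit _ _ hr)]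

variable (φ : A → B)

theorem rename_eq_unit {s : Term A} : s.rename φ = unit ↔ s = unit := by
  cases s <;> simp [rename]

theorem rename_isSeq {s : Term A} : (s.rename φ).IsSeq ↔ s.IsSeq := by
  cases s <;> simp [rename, IsSeq]

theorem rename_isPar {s : Term A} : (s.rename φ).IsPar ↔ s.IsPar := by
  cases s <;> simp [rename, IsPar]

theorem rename_reduced {s : Term A} (h : s.Reduced) : (s.rename φ).Reduced := by
  induction s with
  | unit => trivial
  | atom a => trivial
  | seq s t ihs iht =>
    exact ⟨ihs h.1, iht h.2.1, by simpa [rename_eq_unit] using h.2.2.1,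
      by simpa [rename_eq_unit] using h.2.2.2.1, by simpa [rename_isSeq] using h.2.2.2.2⟩
  | par s t ihs iht =>
    exact ⟨ihs h.1, iht h.2.1, by simpa [rename_eq_unit] using h.2.2.1,
      by simpa [rename_eq_unit] using h.2.2.2.1, by simpa [rename_isPar] using h.2.2.2.2⟩

theorem rename_seqRed (s t : Term A) :
    (seqRed s t).rename φ = seqRed (s.rename φ) (t.rename φ) := by
  refine seqRed_induction (P := fun s t q => q.rename φ = seqRed (s.rename φ) (t.rename φ))
    ?_ ?_ ?_ ?_ s t
  · simp [rename]
  · simp [rename]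
  · intro s s' t ht ih
    rw [rename, rename, seqRed_seq _ _ (by simpa [rename_eq_unit] using ht), ih]
  · intro s t hs hs' ht
    rw [rename, seqRed_of_not] <;> simpa [rename_eq_unit, rename_isSeq]

theorem rename_parRed (s t : Term A) :
    (parRed s t).rename φ = parRed (s.rename φ) (t.rename φ) := by
  refine parRed_induction (P := fun s t q => q.rename φ = parRed (s.rename φ) (t.rename φ))
    ?_ ?_ ?_ ?_ s t
  · simp [rename]
  · simp [rename]
  · intro s s' t ht ih
    rw [rename, rename, parRed_par _ _ (by simpa [rename_eq_unit] using ht), ih]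
  · intro s t hs hs' ht
    rw [rename, parRed_of_not] <;> simpa [rename_eq_unit, rename_isPar]

theorem rename_id (s : Term A) : s.rename (fun a => a) = s := by
  induction s <;> simp_all [rename]

theorem rename_rename {C : Type v} (ψ : B → C) (s : Term A) :
    (s.rename φ).rename ψ = s.rename (fun a => ψ (φ a)) := by
  induction s <;> simp_all [rename]

end Term

/-- Duoidal expressions over `A`. -/
@[ext]
structure Expr (A : Type u) : Type u where
  term : Term A
  reduced : term.Reduced

namespace Expr

variable {A B : Type u}

/-- The empty expression. -/
def unit : Expr A := ⟨Term.unit, trivial⟩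

/-- The singleton expressions. -/
def atom (a : A) : Expr A := ⟨Term.atom a, trivial⟩

/-- Sequencing of duoidal expressions. -/
def seq (E F : Expr A) : Expr A :=
  ⟨E.term.seqRed F.term, Term.seqRed_reduced _ _ E.reduced F.reduced⟩

/-- Tensoring of duoidal expressions. -/
def par (E F : Expr A) : Expr A :=
  ⟨E.term.parRed F.term, Term.parRed_reduced _ _ E.reduced F.reduced⟩

/-- Change of types along a function. -/
def map (φ : A → B) (E : Expr A) : Expr B := ⟨E.term.rename φ, Term.rename_reduced φ E.reduced⟩

end Expr

/-! ## Zetless posets -/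

/-- A finite zetless poset with labels in `A`. -/
structure ZetlessPoset (A : Type u) where
  carrier : Type
  finite : Finite carrier
  le : carrier → carrier → Prop
  le_refl : ∀ x, le x x
  le_trans : ∀ x y z, le x y → le y z → le x z
  le_antisymm : ∀ x y, le x y → le y x → x = y
  /-- There is no full copy `x → z ← y → w` of the Z-poset. -/
  zetless : ¬ ∃ x z y w, le x z ∧ le y z ∧ le y w ∧
    IncompRel le x y ∧ IncompRel le x w ∧ IncompRel le z w
  label : carrier → A

namespace ZetlessPoset

variable {A : Type u}

/-- The empty poset. -/
def empty : ZetlessPoset A where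
  carrier := Empty
  finite := inferInstance
  le _ _ := True
  le_refl _ := trivial
  le_trans _ _ _ _ _ := trivial
  le_antisymm x := x.elim
  zetless := fun ⟨x, _⟩ => x.elim
  label x := x.elim

/-- The singleton poset with a given label. -/
def single (a : A) : ZetlessPoset A where
  carrier := Unit
  finite := inferInstance
  le _ _ := True
  le_refl _ := trivial
  le_trans _ _ _ _ _ := trivial
  le_antisymm _ _ _ _ := rfl
  zetless := fun ⟨_, _, _, _, _, _, _, h, _⟩ => h.1 trivial
  label _ := a

/-- Sequencing: the disjoint union, every element of `P` being below every element of `Q`. -/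
def seq (P Q : ZetlessPoset A) : ZetlessPoset A where
  carrier := P.carrier ⊕ Q.carrier
  finite := by have := P.finite; have := Q.finite; infer_instance
  le := Sum.Lex P.le Q.le
  le_refl x := by
    rcases x with x | x
    · exact .inl (P.le_refl x)
    · exact .inr (Q.le_refl x)
  le_trans x y z h h' := by
    rcases h with h | h | _ <;> rcases h' with h' | h' | _
    · exact .inl (P.le_trans _ _ _ h h')
    · exact .sep _ _
    · exact .inr (Q.le_trans _ _ _ h h')
    · exact .sep _ _
  le_antisymm x y h h' := by
    rcases h with h | h | _ <;> rcases h' with h' | h' | _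
    · exact congrArg _ (P.le_antisymm _ _ h h')
    · exact congrArg _ (Q.le_antisymm _ _ h h')
  zetless := by
    rintro ⟨x, z, y, w, h1, h2, h3, h4, h5, h6⟩
    rcases x with x | x <;> rcases y with y | y <;> rcases z with z | z <;> rcases w with w | w <;>
      simp only [IncompRel, Sum.lex_inl_inl, Sum.lex_inr_inr, Sum.lex_inr_inl, Sum.Lex.sep,
        not_true_eq_false, and_false, false_and, not_false_eq_true] at h1 h2 h3 h4 h5 h6
    · exact P.zetless ⟨x, z, y, w, h1, h2, h3, h4, h5, h6⟩
    · exact Q.zetless ⟨x, z, y, w, h1, h2, h3, h4, h5, h6⟩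
  label := Sum.elim P.label Q.label

/-- Tensoring: the disjoint union, elements of `P` and of `Q` being incomparable. -/
def par (P Q : ZetlessPoset A) : ZetlessPoset A where
  carrier := P.carrier ⊕ Q.carrier
  finite := by have := P.finite; have := Q.finite; infer_instance
  le := Sum.LiftRel P.le Q.le
  le_refl x := by
    rcases x with x | x
    · exact .inl (P.le_refl x)
    · exact .inr (Q.le_refl x)
  le_trans x y z h h' := by
    rcases h with h | h <;> rcases h' with h' | h'
    · exact .inl (P.le_trans _ _ _ h h')
    · exact .inr (Q.le_trans _ _ _ h h')
  le_antisymm x y h h' := by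
    rcases h with h | h <;> rcases h' with h' | h'
    · exact congrArg _ (P.le_antisymm _ _ h h')
    · exact congrArg _ (Q.le_antisymm _ _ h h')
  zetless := by
    rintro ⟨x, z, y, w, h1, h2, h3, h4, h5, h6⟩
    rcases h1 with h1 | h1 <;> rcases h2 with h2 | h2 <;> rcases h3 with h3 | h3 <;>
      simp only [IncompRel, Sum.liftRel_inl_inl, Sum.liftRel_inr_inr] at h4 h5 h6
    · exact P.zetless ⟨_, _, _, _, h1, h2, h3, h4, h5, h6⟩
    · exact Q.zetless ⟨_, _, _, _, h1, h2, h3, h4, h5, h6⟩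
  label := Sum.elim P.label Q.label

/-- Type-preserving, bijective-on-objects inclusions of zetless posets. -/
@[ext]
structure Inclusion (P Q : ZetlessPoset A) : Type v where
  equiv : P.carrier ≃ Q.carrier
  le : ∀ x y, P.le x y → Q.le (equiv x) (equiv y)
  label : ∀ x, Q.label (equiv x) = P.label x

namespace Inclusion

variable {P P' Q Q' R : ZetlessPoset A}

/-- The identity inclusion. -/
def id (P : ZetlessPoset A) : Inclusion.{v} P P := ⟨Equiv.refl _, fun _ _ h => h, fun _ => rfl⟩

/-- Composition of inclusions. -/
def comp (f : Inclusion.{v} P Q) (g : Inclusion.{v} Q R) : Inclusion.{v} P R :=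
  ⟨f.equiv.trans g.equiv, fun _ _ h => g.le _ _ (f.le _ _ h),
    fun x => (g.label _).trans (f.label x)⟩

/-- Sequencing of inclusions. -/
def seq (f : Inclusion.{v} P P') (g : Inclusion.{v} Q Q') :
    Inclusion.{v} (P.seq Q) (P'.seq Q') where
  equiv := Equiv.sumCongr f.equiv g.equiv
  le _ _ h := by
    rcases h with h | h | _
    · exact .inl (f.le _ _ h)
    · exact .inr (g.le _ _ h)
    · exact .sep _ _
  label x := by
    rcases x with x | x
    · exact f.label x
    · exact g.label x

/-- Tensoring of inclusions. -/
def par (f : Inclusion.{v} P P') (g : Inclusion.{v} Q Q') :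
    Inclusion.{v} (P.par Q) (P'.par Q') where
  equiv := Equiv.sumCongr f.equiv g.equiv
  le _ _ h := by
    rcases h with h | h
    · exact .inl (f.le _ _ h)
    · exact .inr (g.le _ _ h)
  label x := by
    rcases x with x | x
    · exact f.label x
    · exact g.label x

/-- The symmetry of tensoring. -/
def sym (P Q : ZetlessPoset A) : Inclusion.{v} (P.par Q) (Q.par P) where
  equiv := Equiv.sumComm P.carrier Q.carrier
  le _ _ h := by
    rcases h with h | h
    · exact .inr h
    · exact .inl h
  label x := by rcases x with x | x <;> rfl

/-- The distributor of tensoring over sequencing. -/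
def d (P P' Q Q' : ZetlessPoset A) :
    Inclusion.{v} ((P.seq Q).par (P'.seq Q')) ((P.par P').seq (Q.par Q')) where
  equiv := Equiv.sumSumSumComm P.carrier Q.carrier P'.carrier Q'.carrier
  le _ _ h := by
    rcases h with h | h <;> rcases h with h | h | _
    · exact .inl (.inl h)
    · exact .inr (.inl h)
    · exact .sep _ _
    · exact .inl (.inr h)
    · exact .inr (.inr h)
    · exact .sep _ _
  label x := by rcases x with (x | x) | (x | x) <;> rfl

end Inclusion

end ZetlessPoset

/-- The zetless poset corresponding to an expression. -/
def Term.encode {A : Type u} : Term A → ZetlessPoset A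
  | unit => .empty
  | atom a => .single a
  | seq s t => s.encode.seq t.encode
  | par s t => s.encode.par t.encode

/-! ## Positions

The elements of the poset of an expression are the leaves of the expression. They are numbered
from left to right. -/

namespace Term

variable {A : Type u} {B : Type w}

/-- The number of leaves. -/
def size : Term A → ℕ
  | unit => 0
  | atom _ => 1
  | seq s t => s.size + t.size
  | par s t => s.size + t.size

/-- The position of a leaf. -/
def pos : (t : Term A) → t.encode.carrier → ℕ
  | unit, x => Empty.elim x
  | atom _, _ => 0
  | seq s t, x => Sum.elim s.pos (fun y => s.size + t.pos y) x
  | par s t, x => Sum.elim s.pos (fun y => s.size + t.pos y) x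

/-- The order of the poset of an expression in terms of positions. -/
def posLE : Term A → ℕ → ℕ → Prop
  | unit, _, _ => False
  | atom _, i, j => i = 0 ∧ j = 0
  | seq s t, i, j => s.posLE i j ∨ (i < s.size ∧ s.size ≤ j ∧ j < s.size + t.size) ∨
      (s.size ≤ i ∧ s.size ≤ j ∧ t.posLE (i - s.size) (j - s.size))
  | par s t, i, j => s.posLE i j ∨
      (s.size ≤ i ∧ s.size ≤ j ∧ t.posLE (i - s.size) (j - s.size))

theorem length_atoms (t : Term A) : t.atoms.length = t.size := by
  induction t <;> simp_all [atoms, size]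

theorem pos_lt (t : Term A) (x : t.encode.carrier) : t.pos x < t.size := by
  induction t with
  | unit => exact Empty.elim x
  | atom a => exact Nat.one_pos
  | seq s t ihs iht =>
    rcases x with x | x
    · exact Nat.lt_add_right _ (ihs x)
    · exact Nat.add_lt_add_left (iht x) _
  | par s t ihs iht =>
    rcases x with x | x
    · exact Nat.lt_add_right _ (ihs x)
    · exact Nat.add_lt_add_left (iht x) _

theorem sumPos_injective {α β : Type} {f : α → ℕ} {g : β → ℕ} {n : ℕ} (hf : f.Injective)
    (hg : g.Injective) (hn : ∀ x, f x < n) :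
    Function.Injective (Sum.elim f (fun y => n + g y)) := by
  rintro (x | x) (y | y) h
  · exact congrArg _ (hf h)
  · have := hn x; simp only [Sum.elim_inl, Sum.elim_inr] at h; omega
  · have := hn y; simp only [Sum.elim_inl, Sum.elim_inr] at h; omega
  · exact congrArg _ (hg (Nat.add_left_cancel h))

theorem pos_injective (t : Term A) : Function.Injective t.pos := by
  induction t with
  | unit => exact fun x => Empty.elim x
  | atom a => exact fun _ _ _ => rfl
  | seq s t ihs iht => exact sumPos_injective ihs iht s.pos_lt
  | par s t ihs iht => exact sumPos_injective ihs iht s.pos_lt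

theorem exists_pos (t : Term A) {i : ℕ} (h : i < t.size) : ∃ x, t.pos x = i := by
  induction t generalizing i with
  | unit => exact absurd h (Nat.not_lt_zero _)
  | atom a => exact ⟨(), (Nat.lt_one_iff.mp h).symm⟩
  | seq s t ihs iht | par s t ihs iht =>
    by_cases hi : i < s.size
    · obtain ⟨x, hx⟩ := ihs hi
      exact ⟨Sum.inl x, hx⟩
    · obtain ⟨x, hx⟩ := iht (i := i - s.size) (by simp only [size] at h; omega)
      exact ⟨Sum.inr x, by change s.size + t.pos x = i; omega⟩

theorem atoms_getElem? (t : Term A) (x : t.encode.carrier) :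
    t.atoms[t.pos x]? = some (t.encode.label x) := by
  induction t with
  | unit => exact Empty.elim x
  | atom a => rfl
  | seq s t ihs iht | par s t ihs iht =>
    rcases x with x | x
    · change (s.atoms ++ t.atoms)[s.pos x]? = some (s.encode.label x)
      rw [List.getElem?_append_left (by rw [length_atoms]; exact s.pos_lt x), ihs]
    · change (s.atoms ++ t.atoms)[s.size + t.pos x]? = some (t.encode.label x)
      rw [List.getElem?_append_right (by rw [length_atoms]; omega), length_atoms,
        Nat.add_sub_cancel_left, iht]

theorem posLE_lt (t : Term A) {i j : ℕ} (h : t.posLE i j) : i < t.size ∧ j < t.size := by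
  induction t generalizing i j with
  | unit => exact h.elim
  | atom a => exact ⟨by simp [h.1, size], by simp [h.2, size]⟩
  | seq s t ihs iht =>
    rcases h with h | h | ⟨h1, h2, h3⟩
    · have := ihs h; simp only [size]; omega
    · simp only [size]; omega
    · have := iht h3; simp only [size]; omega
  | par s t ihs iht =>
    rcases h with h | ⟨h1, h2, h3⟩
    · have := ihs h; simp only [size]; omega
    · have := iht h3; simp only [size]; omega

theorem le_iff_posLE (t : Term A) (x y : t.encode.carrier) :
    t.encode.le x y ↔ t.posLE (t.pos x) (t.pos y) := by
  induction t with
  | unit => exact Empty.elim x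
  | atom a => exact ⟨fun _ => ⟨rfl, rfl⟩, fun _ => trivial⟩
  | seq s t ihs iht =>
    rcases x with x | x <;> rcases y with y | y
    · have h1 := s.pos_lt x
      refine Sum.lex_inl_inl.trans ((ihs x y).trans ⟨Or.inl, ?_⟩)
      rintro (h | h | h)
      · exact h
      · exact absurd (s.pos_lt y) (Nat.not_lt.mpr h.2.1)
      · exact absurd h1 (Nat.not_lt.mpr h.1)
    · exact iff_of_true (.sep _ _) (.inr (.inl ⟨s.pos_lt x, Nat.le_add_right _ _,
        Nat.add_lt_add_left (t.pos_lt y) _⟩))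
    · refine iff_of_false Sum.lex_inr_inl ?_
      rintro (h | h | h)
      · exact absurd (s.posLE_lt h).1 (by change ¬ (s.size + t.pos x < s.size); omega)
      · exact absurd h.1 (by change ¬ (s.size + t.pos x < s.size); omega)
      · exact absurd h.2.1 (Nat.not_le.mpr (s.pos_lt y))
    · refine Sum.lex_inr_inr.trans ((iht x y).trans ⟨fun h => .inr (.inr
        ⟨Nat.le_add_right _ _, Nat.le_add_right _ _, ?_⟩), ?_⟩)
      · change t.posLE (s.size + t.pos x - s.size) (s.size + t.pos y - s.size)
        simpa using h
      · rintro (h | h | h)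
        · exact absurd (s.posLE_lt h).1 (by change ¬ (s.size + t.pos x < s.size); omega)
        · exact absurd h.1 (by change ¬ (s.size + t.pos x < s.size); omega)
        · have h := h.2.2
          change t.posLE (s.size + t.pos x - s.size) (s.size + t.pos y - s.size) at h
          simpa using h
  | par s t ihs iht =>
    rcases x with x | x <;> rcases y with y | y
    · have h1 := s.pos_lt x
      refine Sum.liftRel_inl_inl.trans ((ihs x y).trans ⟨Or.inl, ?_⟩)
      rintro (h | h)
      · exact h
      · exact absurd h1 (Nat.not_lt.mpr h.1)
    · refine iff_of_false Sum.not_liftRel_inl_inr ?_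
      rintro (h | h)
      · exact absurd (s.posLE_lt h).2 (by change ¬ (s.size + t.pos y < s.size); omega)
      · exact absurd h.1 (Nat.not_le.mpr (s.pos_lt x))
    · refine iff_of_false Sum.not_liftRel_inr_inl ?_
      rintro (h | h)
      · exact absurd (s.posLE_lt h).1 (by change ¬ (s.size + t.pos x < s.size); omega)
      · exact absurd h.2.1 (Nat.not_le.mpr (s.pos_lt y))
    · refine Sum.liftRel_inr_inr.trans ((iht x y).trans ⟨fun h => .inr
        ⟨Nat.le_add_right _ _, Nat.le_add_right _ _, ?_⟩, ?_⟩)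
      · change t.posLE (s.size + t.pos x - s.size) (s.size + t.pos y - s.size)
        simpa using h
      · rintro (h | h)
        · exact absurd (s.posLE_lt h).1 (by change ¬ (s.size + t.pos x < s.size); omega)
        · have h := h.2.2
          change t.posLE (s.size + t.pos x - s.size) (s.size + t.pos y - s.size) at h
          simpa using h

/-- Two expressions describing the same labelled order on positions. -/
def SamePoset (s t : Term A) : Prop := s.atoms = t.atoms ∧ s.posLE = t.posLE

theorem SamePoset.symm {s t : Term A} (h : SamePoset s t) : SamePoset t s :=
  ⟨h.1.symm, h.2.symm⟩

theorem SamePoset.trans {s t r : Term A} (h : SamePoset s t) (h' : SamePoset t r) :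
    SamePoset s r := ⟨h.1.trans h'.1, h.2.trans h'.2⟩

theorem SamePoset.size_eq {s t : Term A} (h : SamePoset s t) : s.size = t.size := by
  rw [← length_atoms, ← length_atoms, h.1]

theorem SamePoset.seq {s s' t t' : Term A} (h : SamePoset s s') (h' : SamePoset t t') :
    SamePoset (s.seq t) (s'.seq t') := by
  refine ⟨?_, ?_⟩
  · rw [atoms, atoms, h.1, h'.1]
  · funext i j
    simp only [posLE, h.2, h'.2, h.size_eq, h'.size_eq]

theorem SamePoset.par {s s' t t' : Term A} (h : SamePoset s s') (h' : SamePoset t t') :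
    SamePoset (s.par t) (s'.par t') := by
  refine ⟨?_, ?_⟩
  · rw [atoms, atoms, h.1, h'.1]
  · funext i j
    simp only [posLE, h.2, h'.2, h.size_eq]

theorem samePoset_of_strictPair {s t : Term A} (h : StrictPair s t) : SamePoset s t := by
  cases h with
  | seq_assoc s t r =>
    refine ⟨List.append_assoc _ _ _, ?_⟩
    funext i j
    have h1 := s.posLE_lt (i := i) (j := j)
    have h2 := t.posLE_lt (i := i - s.size) (j := j - s.size)
    have h3 := r.posLE_lt (i := i - (s.size + t.size)) (j := j - (s.size + t.size))
    simp only [posLE, size, Nat.sub_sub, eq_iff_iff]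
    by_cases c1 : s.posLE i j <;> by_cases c2 : t.posLE (i - s.size) (j - s.size) <;>
      by_cases c3 : r.posLE (i - (s.size + t.size)) (j - (s.size + t.size)) <;>
      simp only [c1, c2, c3, true_implies, false_implies, true_or, false_or, and_true,
        and_false, or_false] at h1 h2 h3 ⊢ <;> omega
  | seq_unit_left =>
    refine ⟨rfl, ?_⟩
    funext i j; simp [posLE, size]
  | seq_unit_right s =>
    refine ⟨List.append_nil _, ?_⟩
    funext i j
    simp only [posLE, size, eq_iff_iff, and_false, or_false]
    constructor
    · rintro (h | h)
      · exact h
      · omega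
    · exact Or.inl
  | par_assoc s t r =>
    refine ⟨List.append_assoc _ _ _, ?_⟩
    funext i j
    have h1 := s.posLE_lt (i := i) (j := j)
    have h2 := t.posLE_lt (i := i - s.size) (j := j - s.size)
    have h3 := r.posLE_lt (i := i - (s.size + t.size)) (j := j - (s.size + t.size))
    simp only [posLE, size, Nat.sub_sub, eq_iff_iff]
    by_cases c1 : s.posLE i j <;> by_cases c2 : t.posLE (i - s.size) (j - s.size) <;>
      by_cases c3 : r.posLE (i - (s.size + t.size)) (j - (s.size + t.size)) <;>
      simp only [c1, c2, c3, true_implies, false_implies, true_or, false_or, and_true,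
        and_false, or_false] at h1 h2 h3 ⊢ <;> omega
  | par_unit_left =>
    refine ⟨rfl, ?_⟩
    funext i j; simp [posLE, size]
  | par_unit_right s =>
    refine ⟨List.append_nil _, ?_⟩
    funext i j; simp [posLE]

theorem samePoset_refl (s : Term A) : SamePoset s s := ⟨rfl, rfl⟩

theorem samePoset_seqRed (s t : Term A) : SamePoset (seqRed s t) (s.seq t) := by
  refine seqRed_induction (P := fun s t r => SamePoset r (s.seq t)) ?_ ?_ ?_ ?_ s t
  · exact fun t => (samePoset_of_strictPair (.seq_unit_left t)).symm
  · exact fun t => (samePoset_of_strictPair (.seq_unit_right t)).symm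
  · exact fun s s' t _ ih => ((samePoset_refl s).seq ih).trans
      (samePoset_of_strictPair (.seq_assoc s s' t)).symm
  · exact fun s t _ _ _ => samePoset_refl _

theorem samePoset_parRed (s t : Term A) : SamePoset (parRed s t) (s.par t) := by
  refine parRed_induction (P := fun s t r => SamePoset r (s.par t)) ?_ ?_ ?_ ?_ s t
  · exact fun t => (samePoset_of_strictPair (.par_unit_left t)).symm
  · exact fun t => (samePoset_of_strictPair (.par_unit_right t)).symm
  · exact fun s s' t _ ih => ((samePoset_refl s).par ih).trans
      (samePoset_of_strictPair (.par_assoc s s' t)).symm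
  · exact fun s t _ _ _ => samePoset_refl _

/-- The leaves of an expression, numbered from left to right. -/
noncomputable def posEquiv (t : Term A) : t.encode.carrier ≃ Fin t.size :=
  Equiv.ofBijective (fun x => ⟨t.pos x, t.pos_lt x⟩)
    ⟨fun _ _ h => t.pos_injective (congrArg Fin.val h), fun i => by
      obtain ⟨x, hx⟩ := t.exists_pos i.2
      exact ⟨x, Fin.ext hx⟩⟩

/-- The bijection between the leaves of two expressions of the same size that matches the leaves
from left to right. -/
noncomputable def matchLeaves (s : Term A) (t : Term B) (h : s.size = t.size) :
    s.encode.carrier ≃ t.encode.carrier :=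
  s.posEquiv.trans ((finCongr h).trans t.posEquiv.symm)

theorem pos_matchLeaves (s : Term A) (t : Term B) (h : s.size = t.size) (x : s.encode.carrier) :
    t.pos (matchLeaves s t h x) = s.pos x :=
  congrArg Fin.val (t.posEquiv.apply_symm_apply (finCongr h (s.posEquiv x)))

/-- The inclusion that matches leaves from left to right. -/
noncomputable def SamePoset.inclusion {s t : Term A} (h : SamePoset s t) :
    ZetlessPoset.Inclusion.{v} s.encode t.encode where
  equiv := matchLeaves s t h.size_eq
  le x y hxy := by
    rw [le_iff_posLE, pos_matchLeaves, pos_matchLeaves, ← h.2, ← le_iff_posLE]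
    exact hxy
  label x := by
    apply Option.some.inj
    rw [← atoms_getElem?, ← atoms_getElem?, pos_matchLeaves, h.1]

theorem size_rename (φ : A → B) (t : Term A) : (t.rename φ).size = t.size := by
  induction t <;> simp_all [rename, size]

theorem atoms_rename (φ : A → B) (t : Term A) : (t.rename φ).atoms = t.atoms.map φ := by
  induction t <;> simp_all [rename, atoms]

theorem posLE_rename (φ : A → B) (t : Term A) : (t.rename φ).posLE = t.posLE := by
  induction t with
  | unit => rfl
  | atom a => rfl
  | seq s t ihs iht => funext i j; simp only [rename, posLE, ihs, iht, size_rename]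
  | par s t ihs iht => funext i j; simp only [rename, posLE, ihs, iht, size_rename]

theorem label_matchLeaves (φ : A → B) (t : Term A) (x : (t.rename φ).encode.carrier) :
    (t.rename φ).encode.label x = φ (t.encode.label (matchLeaves _ t (size_rename φ t) x)) := by
  apply Option.some.inj
  rw [← atoms_getElem?, atoms_rename, List.getElem?_map, ← pos_matchLeaves _ t (size_rename φ t) x,
    atoms_getElem?]
  rfl

end Term

namespace Term

variable {A : Type u} {B : Type w}

/-- Change of labels in an inclusion. -/
noncomputable def renameInclusion (φ : A → B) {s t : Term A}
    (f : ZetlessPoset.Inclusion.{v} s.encode t.encode) :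
    ZetlessPoset.Inclusion.{v} (s.rename φ).encode (t.rename φ).encode where
  equiv := (matchLeaves _ s (size_rename φ s)).trans
    (f.equiv.trans (matchLeaves t _ (size_rename φ t).symm))
  le x y h := by
    have key : s.encode.le (matchLeaves _ s (size_rename φ s) x)
        (matchLeaves _ s (size_rename φ s) y) := by
      rw [le_iff_posLE, pos_matchLeaves, pos_matchLeaves, ← posLE_rename φ, ← le_iff_posLE]
      exact h
    have := f.le _ _ key
    rw [le_iff_posLE] at this ⊢
    rw [posLE_rename]
    simp only [Equiv.trans_apply, pos_matchLeaves]
    exact this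
  label x := by
    rw [label_matchLeaves, label_matchLeaves, ← f.label]
    congr 2
    apply t.pos_injective
    simp only [Equiv.trans_apply, pos_matchLeaves]

/-- The action of an inclusion on positions. -/
noncomputable def act (s t : Term A) (f : ZetlessPoset.Inclusion.{v} s.encode t.encode) (i : ℕ) :
    ℕ :=
  if h : i < s.size then t.pos (f.equiv (s.posEquiv.symm ⟨i, h⟩)) else i

theorem act_pos (s t : Term A) (f : ZetlessPoset.Inclusion.{v} s.encode t.encode)
    (x : s.encode.carrier) : act s t f (s.pos x) = t.pos (f.equiv x) := by
  rw [act, dif_pos (s.pos_lt x)]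
  congr 2
  exact s.posEquiv.symm_apply_apply x

theorem act_of_le (s t : Term A) (f : ZetlessPoset.Inclusion.{v} s.encode t.encode) {i : ℕ}
    (h : s.size ≤ i) : act s t f i = i := dif_neg (Nat.not_lt.mpr h)

theorem act_lt (s t : Term A) (f : ZetlessPoset.Inclusion.{v} s.encode t.encode) {i : ℕ}
    (h : i < s.size) : act s t f i < t.size := by
  obtain ⟨x, rfl⟩ := s.exists_pos h
  rw [act_pos]
  exact t.pos_lt _

theorem size_eq_of_inclusion {s t : Term A} (f : ZetlessPoset.Inclusion.{v} s.encode t.encode) :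
    s.size = t.size := by
  simpa using Fintype.card_congr (s.posEquiv.symm.trans (f.equiv.trans t.posEquiv))

theorem inclusion_ext {s t : Term A} {f g : ZetlessPoset.Inclusion.{v} s.encode t.encode}
    (h : ∀ i, i < s.size → act s t f i = act s t g i) : f = g := by
  apply ZetlessPoset.Inclusion.ext
  ext x
  apply t.pos_injective
  rw [← act_pos, ← act_pos, h _ (s.pos_lt x)]

theorem act_eq (s t : Term A) (f : ZetlessPoset.Inclusion.{v} s.encode t.encode) (p : ℕ → ℕ)
    (h : ∀ x, p (s.pos x) = t.pos (f.equiv x)) (h' : ∀ i, s.size ≤ i → p i = i) :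
    act s t f = p := by
  funext i
  by_cases hi : i < s.size
  · obtain ⟨x, rfl⟩ := s.exists_pos hi
    rw [act_pos, h]
  · rw [act_of_le _ _ _ (Nat.not_lt.mp hi), h' _ (Nat.not_lt.mp hi)]

theorem act_id (s : Term A) : act s s (.id s.encode) = id :=
  act_eq _ _ _ _ (fun _ => rfl) (fun _ _ => rfl)

theorem act_comp (s t r : Term A) (f : ZetlessPoset.Inclusion.{v} s.encode t.encode)
    (g : ZetlessPoset.Inclusion.{v} t.encode r.encode) :
    act s r (f.comp g) = act t r g ∘ act s t f := by
  refine act_eq _ _ _ _ (fun x => ?_) (fun i hi => ?_)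
  · rw [Function.comp, act_pos, act_pos]; rfl
  · rw [Function.comp, act_of_le s t f hi, act_of_le]
    rwa [← size_eq_of_inclusion f]

theorem act_samePoset {s t : Term A} (h : SamePoset s t) : act s t h.inclusion.{v} = id :=
  act_eq _ _ _ _ (fun x => (pos_matchLeaves s t h.size_eq x).symm) (fun _ _ => rfl)

theorem act_rename (φ : A → B) {s t : Term A}
    (f : ZetlessPoset.Inclusion.{v} s.encode t.encode) :
    act _ _ (renameInclusion φ f) = act s t f := by
  refine act_eq _ _ _ _ (fun x => ?_) (fun i hi => ?_)
  · rw [← pos_matchLeaves _ s (size_rename φ s), act_pos]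
    exact (pos_matchLeaves _ _ _ _).symm
  · exact act_of_le _ _ _ (by rwa [size_rename] at hi)

/-- The map acting as `p` on the first `n` numbers and as `q` on the following ones. -/
def block (n : ℕ) (p q : ℕ → ℕ) (i : ℕ) : ℕ := if i < n then p i else n + q (i - n)

/-- The exchange of a block of length `n` with the following block of length `m`. -/
def swap (n m : ℕ) (i : ℕ) : ℕ := if i < n then m + i else if i < n + m then i - n else i

/-- The exchange of a block of length `m` with the following block of length `k`, after an initial
block of length `n`. -/
def mid (n m k : ℕ) (i : ℕ) : ℕ := block n id (swap m k) i

theorem block_pos {α β α' β' : Type} {f : α → ℕ} {g : β → ℕ} {f' : α' → ℕ} {g' : β' → ℕ}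
    {n : ℕ} (hn : ∀ x, f x < n) {e : α ≃ α'} {e' : β ≃ β'} {p q : ℕ → ℕ}
    (hp : ∀ x, p (f x) = f' (e x)) (hq : ∀ x, q (g x) = g' (e' x)) (x : α ⊕ β) :
    block n p q (Sum.elim f (fun y => n + g y) x) =
      Sum.elim f' (fun y => n + g' y) (Equiv.sumCongr e e' x) := by
  rcases x with x | x
  · simp [block, hn, hp]
  · simp [block, hq]

theorem act_seq {s s' t t' : Term A} (f : ZetlessPoset.Inclusion.{v} s.encode s'.encode)
    (g : ZetlessPoset.Inclusion.{v} t.encode t'.encode) :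
    act (s.seq t) (s'.seq t') (f.seq g) = block s.size (act s s' f) (act t t' g) := by
  refine act_eq _ _ _ _ (fun x => ?_) (fun i hi => ?_)
  · refine (block_pos s.pos_lt (act_pos s s' f) (act_pos t t' g) x).trans ?_
    rw [size_eq_of_inclusion f]; rfl
  · simp only [size] at hi
    rw [block, if_neg (by omega), act_of_le _ _ _ (by omega)]
    omega

theorem act_par {s s' t t' : Term A} (f : ZetlessPoset.Inclusion.{v} s.encode s'.encode)
    (g : ZetlessPoset.Inclusion.{v} t.encode t'.encode) :
    act (s.par t) (s'.par t') (f.par g) = block s.size (act s s' f) (act t t' g) := by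
  refine act_eq _ _ _ _ (fun x => ?_) (fun i hi => ?_)
  · refine (block_pos s.pos_lt (act_pos s s' f) (act_pos t t' g) x).trans ?_
    rw [size_eq_of_inclusion f]; rfl
  · simp only [size] at hi
    rw [block, if_neg (by omega), act_of_le _ _ _ (by omega)]
    omega

theorem act_sym (s t : Term A) :
    act (s.par t) (t.par s) (.sym s.encode t.encode) = swap s.size t.size := by
  refine act_eq _ _ _ _ (fun x => ?_) (fun i hi => ?_)
  · rcases x with x | x
    · exact if_pos (s.pos_lt x)
    · change swap s.size t.size (s.size + t.pos x) = t.pos x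
      have := t.pos_lt x
      rw [swap, if_neg (by omega), if_pos (by omega)]; omega
  · simp only [size] at hi
    rw [swap, if_neg (by omega), if_neg (by omega)]

theorem act_d (x z y w : Term A) :
    act ((x.seq z).par (y.seq w)) ((x.par y).seq (z.par w))
      (.d x.encode y.encode z.encode w.encode) = mid x.size z.size y.size := by
  refine act_eq _ _ _ _ (fun a => ?_) (fun i hi => ?_)
  · rcases a with (a | a) | (a | a)
    · exact if_pos (x.pos_lt a)
    · change mid x.size z.size y.size (x.size + z.pos a) = (x.size + y.size) + z.pos a
      have := z.pos_lt a
      simp only [mid, block, swap]; split_ifs <;> omega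
    · change mid x.size z.size y.size ((x.size + z.size) + y.pos a) = x.size + y.pos a
      have := y.pos_lt a
      simp only [mid, block, swap, id]; split_ifs <;> omega
    · change mid x.size z.size y.size ((x.size + z.size) + (y.size + w.pos a)) =
        (x.size + y.size) + (z.size + w.pos a)
      simp only [mid, block, swap, id]; split_ifs <;> omega
  · simp only [size] at hi
    simp only [mid, block, swap, id]; split_ifs <;> omega

/-- The maps of positions that act on the first `n` numbers only. -/
structure ActsOn (n : ℕ) (p : ℕ → ℕ) : Prop where
  lt : ∀ {i}, i < n → p i < n
  eq : ∀ {i}, n ≤ i → p i = i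

theorem block_id (n : ℕ) : block n id id = id := by
  funext i; simp only [block, id]; split_ifs <;> omega

theorem block_comp {n : ℕ} {p p' q q' : ℕ → ℕ} (hp : ActsOn n p) :
    block n (p' ∘ p) (q' ∘ q) = block n p' q' ∘ block n p q := by
  funext i
  by_cases h : i < n
  · simp [block, h, hp.lt h]
  · simp [block, h]

theorem block_assoc (n m : ℕ) (p q r : ℕ → ℕ) :
    block (n + m) (block n p q) r = block n p (block m q r) := by
  funext i
  rcases lt_or_ge i n with h | h
  · simp [block, h, Nat.lt_add_right m h]
  obtain ⟨j, rfl⟩ := Nat.exists_eq_add_of_le h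
  rcases lt_or_ge j m with h | h
  · simp [block, h]
  obtain ⟨k, rfl⟩ := Nat.exists_eq_add_of_le h
  simp only [block]
  rw [if_neg (by omega), if_neg (by omega), if_neg (by omega)]
  have e1 : n + (m + k) - (n + m) = k := by omega
  have e2 : n + (m + k) - n - m = k := by omega
  rw [e1, e2]; omega

theorem block_zero (p q : ℕ → ℕ) : block 0 p q = q := by
  funext i; simp [block]

theorem block_id_right {n : ℕ} {p : ℕ → ℕ} (hp : ActsOn n p) : block n p id = p := by
  funext i
  simp only [block, id]
  split_ifs with h
  · rfl
  · rw [hp.eq (by omega)]; omega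

theorem ActsOn.block {n m : ℕ} {p q : ℕ → ℕ} (hp : ActsOn n p) (hq : ActsOn m q) :
    ActsOn (n + m) (block n p q) where
  lt {i} h := by
    simp only [Term.block]
    split_ifs with h'
    · have := hp.lt h'; omega
    · have := hq.lt (i := i - n) (by omega); omega
  eq {i} h := by
    rw [Term.block, if_neg (by omega), hq.eq (by omega)]; omega

theorem swap_swap (n m : ℕ) : swap m n ∘ swap n m = id := by
  funext i; simp only [Function.comp, swap, id]; split_ifs <;> omega

theorem swap_natural {n m : ℕ} {p q : ℕ → ℕ} (hp : ActsOn n p) (hq : ActsOn m q) :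
    swap n m ∘ block n p q = block m q p ∘ swap n m := by
  funext i
  rcases lt_or_ge i n with h | h
  · simp [block, swap, h, hp.lt h]
  obtain ⟨j, rfl⟩ := Nat.exists_eq_add_of_le h
  rcases lt_or_ge j m with h | h
  · have := hq.lt h
    simp [block, swap, h, this]
  · have h' : n ≤ n + j - m := by omega
    have e1 : block n p q (n + j) = n + j := by
      rw [block, if_neg (by omega), Nat.add_sub_cancel_left, hq.eq h]
    have e2 : swap n m (n + j) = n + j := by
      rw [swap, if_neg (by omega), if_neg (by omega)]
    rw [Function.comp, Function.comp, e1, e2, block, if_neg (by omega), hp.eq h']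
    omega

theorem swap_hexagon (x y z : ℕ) :
    swap (x + y) z = block (x + z) (swap x z) id ∘ block x id (swap y z) := by
  funext i
  simp only [Function.comp, swap, block, id]
  split_ifs <;> omega

theorem block_congr {n m : ℕ} (h : n = m) {p p' q q' : ℕ → ℕ} (hp : p = p') (hq : q = q') :
    block n p q = block m p' q' := by rw [h, hp, hq]

theorem mid_natural {x y z : ℕ} {f g h k : ℕ → ℕ} (_ : ActsOn x f) (hg : ActsOn y g)
    (hh : ActsOn z h) :
    mid x z y ∘ block (x + z) (block x f h) (block y g k) =
      block (x + y) (block x f g) (block z h k) ∘ mid x z y := by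
  have e : ∀ i, mid x z y i = block x id (swap z y) i := fun _ => rfl
  have e1 : block (x + z) (block x f h) (block y g k) = block x f (block (z + y) (block z h g) k) := by
    rw [block_assoc, block_assoc]
  have e2 : block (x + y) (block x f g) (block z h k) = block x f (block (y + z) (block y g h) k) := by
    rw [block_assoc, block_assoc]
  have e3 : swap z y ∘ block (z + y) (block z h g) k = block (y + z) (block y g h) k ∘ swap z y := by
    funext i
    have n1 := congrFun (swap_natural hh hg) i
    simp only [Function.comp] at n1 ⊢
    rcases lt_or_ge i (z + y) with hi | hi
    · have hs : swap z y i < y + z := by simp only [swap]; split_ifs <;> omega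
      rw [block, if_pos hi, n1, block, block, if_pos hs]
      rfl
    · have hs : ∀ j, z + y ≤ j → swap z y j = j := by
        intro j hj; simp only [swap]; split_ifs <;> omega
      rw [hs i hi, block, if_neg (by omega), hs _ (by omega), block, if_neg (by omega),
        Nat.add_comm y z]
  have em : mid x z y = block x id (swap z y) := funext e
  have hb : block x f (swap z y ∘ block (z + y) (block z h g) k) =
      block x id (swap z y) ∘ block x f (block (z + y) (block z h g) k) := by
    rw [← block_comp ‹_›]; rfl
  have hid : ActsOn x id := ⟨fun h => h, fun _ => rfl⟩
  rw [e1, e2, em, ← hb, e3, ← block_comp hid]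
  rfl

end Term

/-! ## The category of zetless maps -/

/-- The category of zetless maps: its objects are duoidal expressions, its morphisms are
type-preserving, bijective-on-objects inclusions between the corresponding zetless posets. -/
instance zetlessCategory (A : Type u) : Category.{v} (Expr A) where
  Hom E F := ZetlessPoset.Inclusion.{v} E.term.encode F.term.encode
  id E := .id E.term.encode
  comp f g := f.comp g
  id_comp _ := rfl
  comp_id _ := rfl
  assoc _ _ _ := rfl

namespace Expr

variable {A B : Type u}

/-- Zetless maps: the morphisms of the category of zetless maps. -/
abbrev Map (E F : Expr A) : Type v :=
  @Quiver.Hom (Expr A) (zetlessCategory.{v} A).toCategoryStruct.toQuiver E F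

/-- The number of leaves. -/
def size (E : Expr A) : ℕ := E.term.size

/-- The action of a zetless map on positions. -/
noncomputable def act {E F : Expr A} (f : Map.{v} E F) : ℕ → ℕ :=
  Term.act E.term F.term f

theorem size_eq {E F : Expr A} (f : Map.{v} E F) : E.size = F.size :=
  Term.size_eq_of_inclusion (s := E.term) (t := F.term) f

theorem actsOn {E F : Expr A} (f : Map.{v} E F) : Term.ActsOn E.size (act f) :=
  ⟨fun h => (Term.act_lt _ _ _ h).trans_eq (size_eq f).symm, fun h => Term.act_of_le _ _ _ h⟩

theorem act_id (E : Expr A) : act (CategoryStruct.id.{v} E) = id := Term.act_id _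

theorem act_comp {E F G : Expr A} (f : Map.{v} E F) (g : Map.{v} F G) :
    act (f ≫ g) = act g ∘ act f := Term.act_comp _ _ _ _ _

theorem hom_ext {E F : Expr A} {f g : Map.{v} E F} (h : act f = act g) : f = g :=
  Term.inclusion_ext (s := E.term) (t := F.term) fun i _ => congrFun h i

theorem hom_heq {E E' F F' : Expr A} (hE : E = E') (hF : F = F') {f : Map.{v} E F}
    {g : Map.{v} E' F'} (h : act f = act g) : HEq f g := by
  subst hE hF
  exact heq_of_eq (hom_ext h)

theorem act_heq {E E' F F' : Expr A} (hE : E = E') (hF : F = F') {f : Map.{v} E F}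
    {g : Map.{v} E' F'} (h : HEq f g) : act f = act g := by
  subst hE hF
  cases h; rfl

theorem act_eqToHom {E F : Expr A} (h : E = F) : act (eqToHom.{v} h) = id := by
  subst h; exact act_id E

theorem size_seq (E F : Expr A) : (E.seq F).size = E.size + F.size :=
  (Term.samePoset_seqRed _ _).size_eq

theorem size_par (E F : Expr A) : (E.par F).size = E.size + F.size :=
  (Term.samePoset_parRed _ _).size_eq

/-- Sequencing of zetless maps. -/
noncomputable def seqMap {E E' F F' : Expr A} (f : Map.{v} E E')
    (g : Map.{v} F F') : Map.{v} (E.seq F) (E'.seq F') :=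
  ((Term.samePoset_seqRed E.term F.term).inclusion.comp (ZetlessPoset.Inclusion.seq f g)).comp
    (Term.samePoset_seqRed E'.term F'.term).symm.inclusion

/-- Tensoring of zetless maps. -/
noncomputable def parMap {E E' F F' : Expr A} (f : Map.{v} E E')
    (g : Map.{v} F F') : Map.{v} (E.par F) (E'.par F') :=
  ((Term.samePoset_parRed E.term F.term).inclusion.comp (ZetlessPoset.Inclusion.par f g)).comp
    (Term.samePoset_parRed E'.term F'.term).symm.inclusion

/-- The symmetry. -/
noncomputable def symMap (E F : Expr A) : Map.{v} (E.par F) (F.par E) :=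
  ((Term.samePoset_parRed E.term F.term).inclusion.comp
    (ZetlessPoset.Inclusion.sym E.term.encode F.term.encode)).comp
    (Term.samePoset_parRed F.term E.term).symm.inclusion

theorem same_dom (X Y Z W : Expr A) :
    Term.SamePoset ((X.seq Z).par (Y.seq W)).term
      ((X.term.seq Z.term).par (Y.term.seq W.term)) :=
  (Term.samePoset_parRed _ _).trans
    ((Term.samePoset_seqRed _ _).par (Term.samePoset_seqRed _ _))

theorem same_cod (X Y Z W : Expr A) :
    Term.SamePoset ((X.par Y).seq (Z.par W)).term
      ((X.term.par Y.term).seq (Z.term.par W.term)) :=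
  (Term.samePoset_seqRed _ _).trans
    ((Term.samePoset_parRed _ _).seq (Term.samePoset_parRed _ _))

/-- The distributor. -/
noncomputable def dMap (X Y Z W : Expr A) :
    Map.{v} ((X.seq Z).par (Y.seq W)) ((X.par Y).seq (Z.par W)) :=
  ((same_dom X Y Z W).inclusion.comp (ZetlessPoset.Inclusion.d X.term.encode Y.term.encode
    Z.term.encode W.term.encode)).comp (same_cod X Y Z W).symm.inclusion

theorem act_conj {s s' t t' : Term A} (h : Term.SamePoset s s') (h' : Term.SamePoset t t')
    (f : ZetlessPoset.Inclusion.{v} s'.encode t'.encode) :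
    Term.act s t ((h.inclusion.comp f).comp h'.symm.inclusion) = Term.act s' t' f := by
  rw [Term.act_comp s t' t, Term.act_comp s s' t', Term.act_samePoset, Term.act_samePoset]
  rfl

theorem act_seqMap {E E' F F' : Expr A} (f : Map.{v} E E')
    (g : Map.{v} F F') : act (seqMap f g) = Term.block E.size (act f) (act g) :=
  (act_conj (Term.samePoset_seqRed E.term F.term) (Term.samePoset_seqRed E'.term F'.term)
    (ZetlessPoset.Inclusion.seq f g)).trans (Term.act_seq _ _)

theorem act_parMap {E E' F F' : Expr A} (f : Map.{v} E E')
    (g : Map.{v} F F') : act (parMap f g) = Term.block E.size (act f) (act g) :=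
  (act_conj (Term.samePoset_parRed E.term F.term) (Term.samePoset_parRed E'.term F'.term)
    (ZetlessPoset.Inclusion.par f g)).trans (Term.act_par _ _)

theorem act_symMap (E F : Expr A) : act (symMap.{v} E F) = Term.swap E.size F.size :=
  (act_conj (Term.samePoset_parRed E.term F.term) (Term.samePoset_parRed F.term E.term)
    (ZetlessPoset.Inclusion.sym _ _)).trans (Term.act_sym _ _)

theorem act_dMap (X Y Z W : Expr A) :
    act (dMap.{v} X Y Z W) = Term.mid X.size Z.size Y.size :=
  (act_conj (same_dom X Y Z W) (same_cod X Y Z W) (ZetlessPoset.Inclusion.d _ _ _ _)).trans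
    (Term.act_d _ _ _ _)

theorem seq_assoc (E F G : Expr A) : (E.seq F).seq G = E.seq (F.seq G) :=
  Expr.ext (Term.seqRed_assoc _ _ _)

theorem par_assoc (E F G : Expr A) : (E.par F).par G = E.par (F.par G) :=
  Expr.ext (Term.parRed_assoc _ _ _)

theorem unit_seq (E : Expr A) : unit.seq E = E := Expr.ext (Term.seqRed_unit_left _)

theorem seq_unit (E : Expr A) : E.seq unit = E := Expr.ext (Term.seqRed_unit_right _)

theorem unit_par (E : Expr A) : unit.par E = E := Expr.ext (Term.parRed_unit_left _)

theorem par_unit (E : Expr A) : E.par unit = E := Expr.ext (Term.parRed_unit_right _)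

/-- The sequential strict monoidal structure. -/
noncomputable def seqMonoidal (A : Type u) :
    @StrictMonoidal (Expr A) (zetlessCategory.{v} A) unit where
  obj := seq
  map := seqMap
  map_id X Y := hom_ext (by simp only [act_seqMap, act_id, Term.block_id])
  map_comp f f' g g' := hom_ext (by
    simp only [act_seqMap, act_comp, ← size_eq f, Term.block_comp (actsOn f)])
  assoc := seq_assoc
  unit_left := unit_seq
  unit_right := seq_unit
  map_assoc f g h := hom_heq (seq_assoc _ _ _) (seq_assoc _ _ _) (by
    simp only [act_seqMap, size_seq, Term.block_assoc])
  map_unit_left f := hom_heq (unit_seq _) (unit_seq _) (by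
    rw [act_seqMap]; exact Term.block_zero _ _)
  map_unit_right f := hom_heq (seq_unit _) (seq_unit _) (by
    rw [act_seqMap, act_id, Term.block_id_right (actsOn f)])

/-- The parallel strict monoidal structure. -/
noncomputable def parMonoidal (A : Type u) :
    @StrictMonoidal (Expr A) (zetlessCategory.{v} A) unit where
  obj := par
  map := parMap
  map_id X Y := hom_ext (by simp only [act_parMap, act_id, Term.block_id])
  map_comp f f' g g' := hom_ext (by
    simp only [act_parMap, act_comp, ← size_eq f, Term.block_comp (actsOn f)])
  assoc := par_assoc
  unit_left := unit_par
  unit_right := par_unit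
  map_assoc f g h := hom_heq (par_assoc _ _ _) (par_assoc _ _ _) (by
    simp only [act_parMap, size_par, Term.block_assoc])
  map_unit_left f := hom_heq (unit_par _) (unit_par _) (by
    rw [act_parMap]; exact Term.block_zero _ _)
  map_unit_right f := hom_heq (par_unit _) (par_unit _) (by
    rw [act_parMap, act_id, Term.block_id_right (actsOn f)])

/-- The duoidal structure of the category of zetless maps. -/
noncomputable def duoidal (A : Type u) : @DuoidalStructure (Expr A) (zetlessCategory.{v} A) where
  N := unit
  seq := seqMonoidal A
  par := parMonoidal A
  sym := symMap
  sym_natural f g := hom_ext (by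
    change act (parMap f g ≫ symMap _ _) = act (symMap _ _ ≫ parMap g f)
    simp only [act_comp, act_parMap, act_symMap, ← size_eq f, ← size_eq g,
      Term.swap_natural (actsOn f) (actsOn g)])
  sym_sym X Y := hom_ext (by
    change act (symMap _ _ ≫ symMap _ _) = act (𝟙 _)
    rw [act_comp, act_symMap, act_symMap, Term.swap_swap, act_id])
  hexagon X Y Z := hom_heq (par_assoc X Y Z)
    ((par_assoc Z X Y).symm) (by
    change act (symMap (X.par Y) Z) =
      act (parMap (𝟙 X) (symMap Y Z) ≫ eqToHom _ ≫ parMap (symMap X Z) (𝟙 Y))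
    rw [act_comp, act_comp, act_eqToHom (par_assoc X Z Y).symm]
    simp only [act_symMap, act_parMap, act_id, size_par, Term.swap_hexagon]
    rfl)
  d := dMap
  d_natural f g h k := hom_ext (by
    change act (parMap (seqMap f h) (seqMap g k) ≫ dMap _ _ _ _) =
      act (dMap _ _ _ _ ≫ seqMap (parMap f g) (parMap h k))
    simp only [act_comp, act_seqMap, act_parMap, act_dMap, size_seq, size_par, ← size_eq f,
      ← size_eq g, ← size_eq h, Term.mid_natural (actsOn f) (actsOn g) (actsOn h)])

/-- The list of positions of the value of a term, each given by a leaf of the term and a position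
in the expression assigned to that leaf. -/
def origins (ρ : ℕ → Expr A) : Term ℕ → List (ℕ × ℕ)
  | .unit => []
  | .atom n => (List.range (ρ n).size).map (fun i => (n, i))
  | .seq s t => origins ρ s ++ origins ρ t
  | .par s t => origins ρ s ++ origins ρ t

theorem length_origins (ρ : ℕ → Expr A) (s : Term ℕ) :
    (origins ρ s).length = ((duoidal.{v} A).eval ρ s).size := by
  induction s with
  | unit => rfl
  | atom n => simp [origins, DuoidalStructure.eval]
  | seq s t ihs iht =>
    exact (List.length_append.trans (congrArg₂ _ ihs iht)).trans (size_seq _ _).symm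
  | par s t ihs iht =>
    exact (List.length_append.trans (congrArg₂ _ ihs iht)).trans (size_par _ _).symm

theorem fst_mem_of_mem_origins (ρ : ℕ → Expr A) (s : Term ℕ) {x : ℕ × ℕ}
    (h : x ∈ origins ρ s) : x.1 ∈ s.atoms := by
  induction s with
  | unit => simp [origins] at h
  | atom n =>
    simp only [origins, List.mem_map] at h
    obtain ⟨i, _, rfl⟩ := h
    simp [Term.atoms]
  | seq s t ihs iht | par s t ihs iht =>
    rcases List.mem_append.mp h with h | h
    · exact List.mem_append_left _ (ihs h)
    · exact List.mem_append_right _ (iht h)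

theorem nodup_origins (ρ : ℕ → Expr A) (s : Term ℕ) (h : s.atoms.Nodup) :
    (origins ρ s).Nodup := by
  induction s with
  | unit => exact List.nodup_nil
  | atom n => exact List.nodup_range.map (fun i j h => (Prod.ext_iff.mp h).2)
  | seq s t ihs iht | par s t ihs iht =>
    obtain ⟨h1, h2, h3⟩ := List.nodup_append.mp h
    refine List.nodup_append.mpr ⟨ihs h1, iht h2, fun x hx y hy e => ?_⟩
    exact h3 _ (fst_mem_of_mem_origins ρ s hx) _ (fst_mem_of_mem_origins ρ t hy) (congrArg _ e)

theorem atoms_perm {s t : Term A} (f : FormalMap s t) : s.atoms.Perm t.atoms := by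
  induction f with
  | id => exact .refl _
  | comp _ _ h h' => exact h.trans h'
  | seq _ _ h h' => exact h.append h'
  | par _ _ h h' => exact h.append h'
  | d x y z w =>
    simp only [Term.atoms, List.append_assoc]
    refine List.Perm.append_left _ ?_
    rw [← List.append_assoc, ← List.append_assoc]
    exact List.perm_append_comm.append_right _
  | sym x y => exact List.perm_append_comm
  | strict h => rw [(Term.samePoset_of_strictPair h).1]
  | strictInv h => rw [(Term.samePoset_of_strictPair h).1]

theorem block_getElem? {α : Type} {l l' m m' : List α} {p q : ℕ → ℕ} {n : ℕ} (hl : l.length = n)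
    (hl' : l'.length = n) (hn : Term.ActsOn n p) (hp : ∀ i, l'[p i]? = l[i]?)
    (hq : ∀ i, m'[q i]? = m[i]?) (i : ℕ) :
    (l' ++ m')[Term.block n p q i]? = (l ++ m)[i]? := by
  by_cases h : i < n
  · rw [Term.block, if_pos h, List.getElem?_append_left (by rw [hl']; exact hn.lt h),
      List.getElem?_append_left (by omega), hp]
  · rw [Term.block, if_neg h, List.getElem?_append_right (by omega),
      List.getElem?_append_right (by omega), hl, hl', Nat.add_sub_cancel_left, hq]

theorem swap_getElem? {α : Type} (l m r : List α) (i : ℕ) :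
    (m ++ (l ++ r))[Term.swap l.length m.length i]? = (l ++ (m ++ r))[i]? := by
  simp only [Term.swap, List.getElem?_append]
  split_ifs <;> first | omega | (congr 1; done) | (congr 1; omega)

theorem mid_getElem? {α : Type} (x y z w : List α) (i : ℕ) :
    ((x ++ y) ++ (z ++ w))[Term.mid x.length z.length y.length i]? =
      ((x ++ z) ++ (y ++ w))[i]? := by
  rw [List.append_assoc, List.append_assoc]
  exact block_getElem? rfl rfl ⟨fun h => h, fun _ => rfl⟩ (fun _ => rfl) (swap_getElem? z y w) i

theorem evalMap_origins (ρ : ℕ → Expr A) {s t : Term ℕ} (f : FormalMap s t) (i : ℕ) :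
    (origins ρ t)[act ((duoidal.{v} A).evalMap ρ f) i]? = (origins ρ s)[i]? := by
  induction f generalizing i with
  | id s => exact congrArg (fun p : ℕ → ℕ => (origins ρ s)[p i]?) (act_id.{v} _)
  | comp f g hf hg =>
    rw [DuoidalStructure.evalMap, act_comp, Function.comp, hg, hf]
  | @seq s s' t t' f g hf hg =>
    change (_ ++ _)[act (seqMap _ _) i]? = (_ ++ _)[i]?
    rw [act_seqMap]
    refine block_getElem? (length_origins ρ _) ?_ (actsOn _) hf hg i
    rw [length_origins.{v}]
    exact (size_eq (DuoidalStructure.evalMap (duoidal.{v} A) ρ f)).symm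
  | @par s s' t t' f g hf hg =>
    change (_ ++ _)[act (parMap _ _) i]? = (_ ++ _)[i]?
    rw [act_parMap]
    refine block_getElem? (length_origins ρ _) ?_ (actsOn _) hf hg i
    rw [length_origins.{v}]
    exact (size_eq (DuoidalStructure.evalMap (duoidal.{v} A) ρ f)).symm
  | d x y z w =>
    change ((_ ++ _) ++ (_ ++ _))[act (dMap _ _ _ _) i]? = ((_ ++ _) ++ (_ ++ _))[i]?
    rw [act_dMap, ← length_origins, ← length_origins, ← length_origins]
    exact mid_getElem? _ _ _ _ i
  | sym x y =>
    change (_ ++ _)[act (symMap _ _) i]? = (_ ++ _)[i]?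
    rw [act_symMap, ← length_origins, ← length_origins]
    simpa using swap_getElem? (origins ρ x) (origins ρ y) [] i
  | strict h =>
    rw [DuoidalStructure.evalMap, act_eqToHom]
    cases h <;> simp [origins]
  | strictInv h =>
    rw [DuoidalStructure.evalMap, act_eqToHom]
    cases h <;> simp [origins]

theorem duoidal_coherent (A : Type u) : (duoidal.{v} A).Coherent := by
  intro s t hs f g ρ
  apply Term.inclusion_ext
  intro i hi
  change act _ i = act _ i
  have ht : (origins ρ t).Nodup := nodup_origins ρ t ((atoms_perm f).nodup_iff.mp hs)
  have hf := evalMap_origins.{v} ρ f i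
  have hg := evalMap_origins.{v} ρ g i
  refine (List.getElem?_inj ?_ ht).mp (hf.trans hg.symm)
  rw [length_origins.{v}, ← size_eq (DuoidalStructure.evalMap (duoidal.{v} A) ρ f)]
  exact (actsOn _).lt hi

theorem map_seq (φ : A → B) (E F : Expr A) : (E.seq F).map φ = (E.map φ).seq (F.map φ) :=
  Expr.ext (Term.rename_seqRed φ _ _)

theorem map_par (φ : A → B) (E F : Expr A) : (E.par F).map φ = (E.map φ).par (F.map φ) :=
  Expr.ext (Term.rename_parRed φ _ _)

theorem map_comp {C : Type u} (φ : A ⟶ B) (ψ : B ⟶ C) (E : Expr A) :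
    E.map (φ ≫ ψ) = (E.map φ).map ψ :=
  Expr.ext (Term.rename_rename (fun a => φ a) (fun b => ψ b) E.term).symm

theorem size_map (φ : A → B) (E : Expr A) : (E.map φ).size = E.size := Term.size_rename φ _

/-- The functor changing the types of expressions and transporting inclusions. -/
noncomputable def mapFunctor (φ : A → B) :
    @Functor (Expr A) (zetlessCategory.{v} A) (Expr B) (zetlessCategory.{v} B) where
  obj := map φ
  map f := Term.renameInclusion φ f
  map_id E := Term.inclusion_ext (s := E.term.rename φ) (t := E.term.rename φ) fun i _ =>
    congrFun ((Term.act_rename φ (.id E.term.encode)).trans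
      ((Term.act_id E.term).trans (Term.act_id (E.term.rename φ)).symm)) i
  map_comp {E F G} f g := Term.inclusion_ext (s := E.term.rename φ) (t := G.term.rename φ)
    fun i _ => congrFun ((Term.act_rename φ (s := E.term) (t := G.term)
      (ZetlessPoset.Inclusion.comp f g)).trans ((Term.act_comp E.term F.term G.term f g).trans
        ((Term.act_comp (E.term.rename φ) (F.term.rename φ) (G.term.rename φ) _ _).trans
          (congrArg₂ _ (Term.act_rename φ (s := F.term) (t := G.term) g)
            (Term.act_rename φ (s := E.term) (t := F.term) f))).symm)) i

theorem act_mapFunctor (φ : A → B) {E F : Expr A} (f : Map.{v} E F) :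
    act ((mapFunctor φ).map f) = act f :=
  Term.act_rename φ (s := E.term) (t := F.term) f

theorem mapFunctor_seq (φ : A → B) {E E' F F' : Expr A} (f : Map.{v} E E')
    (g : Map.{v} F F') :
    HEq ((mapFunctor φ).map (seqMap f g)) (seqMap ((mapFunctor φ).map f) ((mapFunctor φ).map g)) :=
  hom_heq (map_seq φ _ _) (map_seq φ _ _) (by
    refine ((act_mapFunctor φ _).trans (act_seqMap f g)).trans (Eq.trans ?_ (act_seqMap _ _).symm)
    exact Term.block_congr (size_map φ _).symm (act_mapFunctor φ f).symm (act_mapFunctor φ g).symm)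

theorem mapFunctor_par (φ : A → B) {E E' F F' : Expr A} (f : Map.{v} E E')
    (g : Map.{v} F F') :
    HEq ((mapFunctor φ).map (parMap f g)) (parMap ((mapFunctor φ).map f) ((mapFunctor φ).map g)) :=
  hom_heq (map_par φ _ _) (map_par φ _ _) (by
    refine ((act_mapFunctor φ _).trans (act_parMap f g)).trans (Eq.trans ?_ (act_parMap _ _).symm)
    exact Term.block_congr (size_map φ _).symm (act_mapFunctor φ f).symm (act_mapFunctor φ g).symm)

theorem mapFunctor_sym (φ : A → B) (X Y : Expr A) :
    HEq ((mapFunctor φ).map (symMap.{v} X Y)) (symMap.{v} (X.map φ) (Y.map φ)) :=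
  hom_heq (map_par φ _ _) (map_par φ _ _) (by
    refine ((act_mapFunctor φ _).trans (act_symMap X Y)).trans (Eq.trans ?_ (act_symMap _ _).symm)
    rw [size_map, size_map])

theorem mapFunctor_d (φ : A → B) (X Y Z W : Expr A) :
    HEq ((mapFunctor φ).map (dMap.{v} X Y Z W))
      (dMap.{v} (X.map φ) (Y.map φ) (Z.map φ) (W.map φ)) :=
  hom_heq ((map_par φ _ _).trans (congrArg₂ _ (map_seq φ _ _) (map_seq φ _ _)))
    ((map_seq φ _ _).trans (congrArg₂ _ (map_par φ _ _) (map_par φ _ _))) (by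
    refine ((act_mapFunctor φ _).trans (act_dMap X Y Z W)).trans (Eq.trans ?_ (act_dMap _ _ _ _).symm)
    rw [size_map, size_map, size_map])

end Expr

/-- The strict physical duoidal category of zetless maps over a set. -/
noncomputable def zetless (A : Type u) : PhyDuo.{v, u} where
  carrier := Expr A
  category := zetlessCategory A
  str := Expr.duoidal A
  coherent := Expr.duoidal_coherent A

/-- The strict physical duoidal functor induced by a function: it changes the types of expressions
and transports inclusions. -/
noncomputable def zetlessMap {A B : Type u} (φ : A → B) :
    PhyDuo.Hom (zetless.{v} A) (zetless.{v} B) where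
  functor := Expr.mapFunctor φ
  obj_N := rfl
  obj_seq := Expr.map_seq φ
  obj_par := Expr.map_par φ
  map_seq := Expr.mapFunctor_seq φ
  map_par := Expr.mapFunctor_par φ
  map_sym := Expr.mapFunctor_sym φ
  map_d := Expr.mapFunctor_d φ

/-- The functor `Zetless : Set ⥤ PhyDuo`. -/
noncomputable def Zetless : Type u ⥤ PhyDuo.{v, u} where
  obj A := zetless A
  map φ := zetlessMap φ
  map_id _ := PhyDuo.Hom.ext (Functor.hext (fun _ => Expr.ext (Term.rename_id _))
    (fun _ _ f => Expr.hom_heq (Expr.ext (Term.rename_id _)) (Expr.ext (Term.rename_id _))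
      (Expr.act_mapFunctor _ f)))
  map_comp φ ψ := PhyDuo.Hom.ext (Functor.hext
    (fun _ => Expr.map_comp φ ψ _)
    (fun _ _ f => Expr.hom_heq (Expr.map_comp φ ψ _)
      (Expr.map_comp φ ψ _)
      ((Expr.act_mapFunctor _ f).trans ((Expr.act_mapFunctor _ _).trans
        (Expr.act_mapFunctor _ f)).symm)))

end PhysicalDuoidal

open PhysicalDuoidal

/-! The theorem rests on two facts: structure maps reach every zetless map, and coherence leaves no
choice in how they do so.

Existence of formulas. Use the leaves of an expression as pairwise distinct variables. A zetless map
then says that two repetition-free terms have the same variables and that the order of the first is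
contained in the order of the second. Such an inclusion is denoted by a formal structure map
(`Term.Reach.of_rel`), by induction on the target. If the target is `t ◁ r`, the variables of `t`
form a lower set for the order of the source, and the source maps to its restriction to them
followed by its restriction to the rest; the distributor does this on tensorings (`seq_restrict`).
If the target is `t ⊗ r`, no relation of the source crosses between the two parts, and the source
splits as a tensoring by symmetries and strictness alone (`par_restrict`). The induction hypothesis
handles the two halves.

Independence of the formula. In the category of zetless maps a formal structure map carries each
position to a position with the same variable, so on repetition-free terms the zetless map denoted
is known from source and target (`atoms_valueMap`). Conversely, two formulas for one zetless map
become parallel after renaming variables and removing brackets and units, so coherence of `V` gives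
them the same value there (`freeMap_heq`).

Hence the value in `V` of any formula for `g` may be taken as the image of `g`. Functoriality and
preservation of the structure follow by choosing, for each equation, formulas over a common set of
variables. Uniqueness holds because a strict functor commutes with the evaluation of formulas
(`map_evalMap`) and every zetless map is the value of a formula at singletons. -/

namespace PhysicalDuoidal

/-! ### Orders on variables and restriction of terms -/

namespace Term

variable {A : Type u}

/-- The strict order that a formal expression without repeated variables puts on its variables. -/
def rel : Term A → A → A → Prop
  | unit, _, _ => False
  | atom _, _, _ => False
  | seq s t, x, y => s.rel x y ∨ t.rel x y ∨ (x ∈ s.atoms ∧ y ∈ t.atoms)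
  | par s t, x, y => s.rel x y ∨ t.rel x y

theorem mem_of_rel {s : Term A} {x y : A} (h : s.rel x y) : x ∈ s.atoms ∧ y ∈ s.atoms := by
  induction s with
  | unit => exact h.elim
  | atom a => exact h.elim
  | seq s t ihs iht =>
    simp only [atoms, List.mem_append]
    rcases h with h | h | h
    · exact ⟨.inl (ihs h).1, .inl (ihs h).2⟩
    · exact ⟨.inr (iht h).1, .inr (iht h).2⟩
    · exact ⟨.inl h.1, .inr h.2⟩
  | par s t ihs iht =>
    simp only [atoms, List.mem_append]
    rcases h with h | h
    · exact ⟨.inl (ihs h).1, .inl (ihs h).2⟩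
    · exact ⟨.inr (iht h).1, .inr (iht h).2⟩

open Classical in
/-- The restriction of a formal expression to the variables satisfying a predicate, the other ones
being replaced by the unit. -/
noncomputable def restrict (p : A → Prop) : Term A → Term A
  | unit => unit
  | atom a => if p a then atom a else unit
  | seq s t => seq (s.restrict p) (t.restrict p)
  | par s t => par (s.restrict p) (t.restrict p)

open Classical in
theorem atoms_restrict (p : A → Prop) (s : Term A) :
    (s.restrict p).atoms = s.atoms.filter p := by
  induction s with
  | unit => rfl
  | atom a => by_cases h : p a <;> simp [restrict, atoms, h]
  | seq s t ihs iht | par s t ihs iht => simp [restrict, atoms, ihs, iht]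

theorem mem_atoms_restrict {p : A → Prop} {s : Term A} {x : A} :
    x ∈ (s.restrict p).atoms ↔ x ∈ s.atoms ∧ p x := by
  simp [atoms_restrict]

theorem nodup_restrict (p : A → Prop) {s : Term A} (h : s.atoms.Nodup) :
    (s.restrict p).atoms.Nodup := by
  rw [atoms_restrict]; exact h.filter _

theorem rel_of_rel_restrict {p : A → Prop} {s : Term A} {x y : A} (h : (s.restrict p).rel x y) :
    s.rel x y := by
  induction s with
  | unit => exact h.elim
  | atom a => by_cases ha : p a <;> simp [restrict, ha, rel] at h
  | seq s t ihs iht =>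
    exact h.imp ihs (Or.imp iht fun h =>
      ⟨(mem_atoms_restrict.mp h.1).1, (mem_atoms_restrict.mp h.2).1⟩)
  | par s t ihs iht => exact h.imp ihs iht

theorem restrict_eq_self {p : A → Prop} {s : Term A} (h : ∀ x ∈ s.atoms, p x) :
    s.restrict p = s := by
  induction s with
  | unit => rfl
  | atom a => exact if_pos (h a (by simp [atoms]))
  | seq s t ihs iht | par s t ihs iht =>
    simp only [atoms, List.mem_append] at h
    rw [restrict, ihs fun x hx => h x (.inl hx), iht fun x hx => h x (.inr hx)]

theorem atoms_restrict_eq_nil {p : A → Prop} {s : Term A} (h : ∀ x ∈ s.atoms, ¬ p x) :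
    (s.restrict p).atoms = [] := by
  rw [List.eq_nil_iff_forall_not_mem]
  intro x hx
  rw [mem_atoms_restrict] at hx
  exact h x hx.1 hx.2

/-! ### Order inclusions are denoted by formal structure maps -/

/-- Existence of a formal structure map. -/
def Reach (s t : Term A) : Prop := Nonempty (FormalMap s t)

namespace Reach

theorem refl (s : Term A) : Reach s s := ⟨.id s⟩

theorem trans {s t r : Term A} : Reach s t → Reach t r → Reach s r
  | ⟨f⟩, ⟨g⟩ => ⟨f.comp g⟩

theorem seq {s s' t t' : Term A} : Reach s s' → Reach t t' → Reach (s.seq t) (s'.seq t')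
  | ⟨f⟩, ⟨g⟩ => ⟨f.seq g⟩

theorem par {s s' t t' : Term A} : Reach s s' → Reach t t' → Reach (s.par t) (s'.par t')
  | ⟨f⟩, ⟨g⟩ => ⟨f.par g⟩

theorem strict {s t : Term A} (h : StrictPair s t) : Reach s t := ⟨.strict h⟩

theorem strictInv {s t : Term A} (h : StrictPair s t) : Reach t s := ⟨.strictInv h⟩

/-- Such a term is a bracketing of units, which unitality collapses. Restriction leaves units in
place of the deleted variables, and this is how they are removed or inserted. -/
theorem of_atoms_eq_nil {s : Term A} (h : s.atoms = []) : Reach s unit ∧ Reach unit s := by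
  induction s with
  | unit => exact ⟨refl _, refl _⟩
  | atom a => simp [atoms] at h
  | seq s t ihs iht =>
    obtain ⟨h1, h2⟩ := List.append_eq_nil_iff.mp h
    exact ⟨((ihs h1).1.seq (iht h2).1).trans (strict (.seq_unit_left _)),
      (strictInv (.seq_unit_left _)).trans ((ihs h1).2.seq (iht h2).2)⟩
  | par s t ihs iht =>
    obtain ⟨h1, h2⟩ := List.append_eq_nil_iff.mp h
    exact ⟨((ihs h1).1.par (iht h2).1).trans (strict (.par_unit_left _)),
      (strictInv (.par_unit_left _)).trans ((ihs h1).2.par (iht h2).2)⟩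

theorem seq_left (s : Term A) {t : Term A} (h : t.atoms = []) : Reach s (t.seq s) :=
  (strictInv (.seq_unit_left s)).trans ((of_atoms_eq_nil h).2.seq (refl s))

theorem seq_right (s : Term A) {t : Term A} (h : t.atoms = []) : Reach s (s.seq t) :=
  (strictInv (.seq_unit_right s)).trans ((refl s).seq (of_atoms_eq_nil h).2)

theorem par_left (s : Term A) {t : Term A} (h : t.atoms = []) : Reach s (t.par s) :=
  (strictInv (.par_unit_left s)).trans ((of_atoms_eq_nil h).2.par (refl s))

theorem par_right (s : Term A) {t : Term A} (h : t.atoms = []) : Reach s (s.par t) :=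
  (strictInv (.par_unit_right s)).trans ((refl s).par (of_atoms_eq_nil h).2)

theorem of_seq_left {s t : Term A} (h : s.atoms = []) : Reach (s.seq t) t :=
  ((of_atoms_eq_nil h).1.seq (refl t)).trans (strict (.seq_unit_left t))

theorem of_seq_right {s t : Term A} (h : t.atoms = []) : Reach (s.seq t) s :=
  ((refl s).seq (of_atoms_eq_nil h).1).trans (strict (.seq_unit_right s))

theorem of_atoms_eq_singleton {s : Term A} {a : A} (h : s.atoms = [a]) : Reach s (atom a) := by
  induction s with
  | unit => simp [atoms] at h
  | atom b =>
    obtain rfl : b = a := by simpa [atoms] using h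
    exact refl _
  | seq s t ihs iht =>
    rcases List.append_eq_singleton_iff.mp h with ⟨h1, h2⟩ | ⟨h1, h2⟩
    · exact (of_seq_left h1).trans (iht h2)
    · exact (of_seq_right h2).trans (ihs h1)
  | par s t ihs iht =>
    rcases List.append_eq_singleton_iff.mp h with ⟨h1, h2⟩ | ⟨h1, h2⟩
    · exact ((of_atoms_eq_nil h1).1.par (iht h2)).trans (strict (.par_unit_left _))
    · exact ((ihs h1).par (of_atoms_eq_nil h2).1).trans (strict (.par_unit_right _))

/-- Rebracket so that the two middle factors are adjacent and exchange them. In `par_restrict` this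
takes the place that the distributor has in `seq_restrict`. -/
theorem par_par_par_comm (a b c d : Term A) :
    Reach ((a.par b).par (c.par d)) ((a.par c).par (b.par d)) :=
  (strict (.par_assoc _ _ _)).trans <| .trans
    ((refl a).par ((strictInv (.par_assoc _ _ _)).trans <| .trans
      (.par ⟨.sym b c⟩ (refl d)) (strict (.par_assoc _ _ _))))
    (strictInv (.par_assoc _ _ _))

/-- An expression is the tensoring of its restrictions to two parts with no relation between
them. -/
theorem par_restrict (p : A → Prop) (s : Term A) (h : ∀ x y, s.rel x y → (p x ↔ p y)) :
    Reach s ((s.restrict p).par (s.restrict fun x => ¬ p x)) := by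
  induction s with
  | unit => exact strictInv (.par_unit_left _)
  | atom a =>
    by_cases ha : p a
    · simpa [restrict, ha] using strictInv (.par_unit_right (Term.atom a))
    · simpa [restrict, ha] using strictInv (.par_unit_left (Term.atom a))
  | par s t ihs iht =>
    exact ((ihs fun x y hxy => h x y (.inl hxy)).par (iht fun x y hxy => h x y (.inr hxy))).trans
      (par_par_par_comm _ _ _ _)
  | seq s t ihs iht =>
    -- If `p` is constant on the variables, one restriction is the whole term and the other consists
    -- of units.
    by_cases h1 : ∀ x ∈ (s.seq t).atoms, p x
    · have h2 : ((s.seq t).restrict fun x => ¬ p x).atoms = [] :=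
        atoms_restrict_eq_nil fun x hx => not_not.mpr (h1 x hx)
      rw [restrict_eq_self h1]
      exact par_right _ h2
    by_cases h2 : ∀ x ∈ (s.seq t).atoms, ¬ p x
    · have h3 : ((s.seq t).restrict p).atoms = [] := atoms_restrict_eq_nil h2
      rw [restrict_eq_self (p := fun x => ¬ p x) h2]
      exact par_left _ h3
    -- Each variable of `s` is below each variable of `t`, so if both are nonempty the comparability
    -- graph is connected. As `p` is constant along relations it would be constant, which the
    -- previous cases exclude.
    have key : t.atoms = [] ∨ s.atoms = [] := by
      by_contra! hc
      obtain ⟨⟨b, hb⟩, ⟨a, ha⟩⟩ := hc.imp (List.exists_mem_of_ne_nil _) (List.exists_mem_of_ne_nil _)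
      have hs : ∀ x ∈ s.atoms, (p x ↔ p b) := fun x hx => h x b (.inr (.inr ⟨hx, hb⟩))
      have ht : ∀ x ∈ t.atoms, (p x ↔ p b) := fun x hx =>
        (h a x (.inr (.inr ⟨ha, hx⟩))).symm.trans (hs a ha)
      have hst : ∀ x ∈ (s.seq t).atoms, (p x ↔ p b) := fun x hx =>
        (List.mem_append.mp hx).elim (hs x) (ht x)
      by_cases hpb : p b
      · exact h1 fun x hx => (hst x hx).mpr hpb
      · exact h2 fun x hx hpx => hpb ((hst x hx).mp hpx)
    rcases key with ht | hs
    · have e : ∀ q : A → Prop, (t.restrict q).atoms = [] := fun q => by simp [atoms_restrict, ht]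
      exact (of_seq_right ht).trans ((ihs fun x y hxy => h x y (.inl hxy)).trans
        ((seq_right _ (e _)).par (seq_right _ (e _))))
    · have e : ∀ q : A → Prop, (s.restrict q).atoms = [] := fun q => by simp [atoms_restrict, hs]
      exact (of_seq_left hs).trans ((iht fun x y hxy => h x y (.inr (.inl hxy))).trans
        ((seq_left _ (e _)).par (seq_left _ (e _))))

/-- An expression maps to the sequence of its restrictions to a lower set and to the
complement. -/
theorem seq_restrict (p : A → Prop) (s : Term A) (h : ∀ x y, s.rel x y → p y → p x) :
    Reach s ((s.restrict p).seq (s.restrict fun x => ¬ p x)) := by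
  induction s with
  | unit => exact strictInv (.seq_unit_left _)
  | atom a =>
    by_cases ha : p a
    · simpa [restrict, ha] using strictInv (.seq_unit_right (Term.atom a))
    · simpa [restrict, ha] using strictInv (.seq_unit_left (Term.atom a))
  | par s t ihs iht =>
    exact ((ihs fun x y hxy => h x y (.inl hxy)).par (iht fun x y hxy => h x y (.inr hxy))).trans
      ⟨.d _ _ _ _⟩
  | seq s t ihs iht =>
    -- A lower set of a sequence cuts only one factor: either it contains all of `s`, or it misses
    -- some `a` in `s` and hence everything in `t`, which lies above `a`.
    by_cases hs : ∀ x ∈ s.atoms, p x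
    · have e : (s.restrict fun x => ¬ p x).atoms = [] :=
        atoms_restrict_eq_nil fun x hx => not_not.mpr (hs x hx)
      rw [restrict, restrict_eq_self hs]
      exact ((refl s).seq (iht fun x y hxy => h x y (.inr (.inl hxy)))).trans
        ((strictInv (.seq_assoc _ _ _)).trans ((refl _).seq (seq_left _ e)))
    · push Not at hs
      obtain ⟨a, ha, hpa⟩ := hs
      have ht : ∀ x ∈ t.atoms, ¬ p x := fun x hx hpx => hpa (h a x (.inr (.inr ⟨ha, hx⟩)) hpx)
      have e : (t.restrict p).atoms = [] := atoms_restrict_eq_nil ht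
      have e' : (t.restrict fun x => ¬ p x) = t := restrict_eq_self ht
      rw [restrict, restrict, e']
      exact ((ihs fun x y hxy => h x y (.inl hxy)).seq (refl t)).trans
        ((strict (.seq_assoc _ _ _)).trans ((seq_right _ e).seq (refl _)))

/-- Inclusions of the orders of expressions without repeated variables are denoted by formal
structure maps. -/
theorem of_rel {s t : Term A} (hs : s.atoms.Nodup) (ht : t.atoms.Nodup)
    (hst : ∀ x, x ∈ s.atoms ↔ x ∈ t.atoms) (h : ∀ x y, s.rel x y → t.rel x y) : Reach s t := by
  induction t generalizing s with
  | unit => exact (of_atoms_eq_nil (List.eq_nil_iff_forall_not_mem.mpr fun x hx => by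
      simpa [atoms] using (hst x).mp hx)).1
  | atom a =>
    exact of_atoms_eq_singleton (List.perm_singleton.mp ((List.perm_ext_iff_of_nodup hs ht).mpr hst))
  | seq t r iht ihr | par t r iht ihr =>
    obtain ⟨h1, h2, h3⟩ := List.nodup_append.mp ht
    simp only [atoms, List.mem_append] at hst
    -- The source is cut along the variables of the first factor of the target. Absence of
    -- repetition makes the complement exactly the variables of the second factor.
    have h1' : ∀ x, x ∈ (s.restrict (· ∈ t.atoms)).atoms ↔ x ∈ t.atoms := fun x => by
      rw [mem_atoms_restrict, hst]; tauto
    have h2' : ∀ x, x ∈ (s.restrict fun x => ¬ x ∈ t.atoms).atoms ↔ x ∈ r.atoms := fun x => by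
      rw [mem_atoms_restrict, hst]
      have := h3 x
      grind
    -- A relation of the target between two variables of `t` comes from `t`: the other possible
    -- sources involve a variable of `r`, and the two factors share none.
    have key1 := @iht (s.restrict (· ∈ t.atoms)) (nodup_restrict _ hs) h1 h1' fun x y hxy => by
      have hm := mem_of_rel hxy
      have hr := h x y (rel_of_rel_restrict hxy)
      rw [h1', h1'] at hm
      simp only [rel] at hr
      have := @mem_of_rel _ r x y
      grind
    have key2 := @ihr (s.restrict fun x => ¬ x ∈ t.atoms) (nodup_restrict _ hs) h2 h2'
      fun x y hxy => by
        have hm := mem_of_rel hxy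
        have hr := h x y (rel_of_rel_restrict hxy)
        rw [h2', h2'] at hm
        simp only [rel] at hr
        have := @mem_of_rel _ t x y
        grind
    -- The first alternative is the case of a sequence, where the variables of `t` are a lower set;
    -- the second is the case of a tensoring, where no relation joins `t` to `r`. Both properties
    -- pass to the order of `s`, which is contained in that of the target.
    first
      | refine (seq_restrict (· ∈ t.atoms) s fun x y hxy hy => ?_).trans (key1.seq key2)
        have hr := h x y hxy
        simp only [rel] at hr
        have := @mem_of_rel _ t x y
        have := @mem_of_rel _ r x y
        grind
      | refine (par_restrict (· ∈ t.atoms) s fun x y hxy => ?_).trans (key1.par key2)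
        have hr := h x y hxy
        simp only [rel] at hr
        have := @mem_of_rel _ t x y
        have := @mem_of_rel _ r x y
        grind

end Reach

end Term

/-! ### Renaming of variables in formal maps -/

theorem StrictPair.rename {A : Type u} {B : Type w} (τ : A → B) {s t : Term A}
    (h : StrictPair s t) : StrictPair (s.rename τ) (t.rename τ) := by
  cases h with
  | seq_assoc => exact .seq_assoc _ _ _
  | seq_unit_left => exact .seq_unit_left _
  | seq_unit_right => exact .seq_unit_right _
  | par_assoc => exact .par_assoc _ _ _
  | par_unit_left => exact .par_unit_left _
  | par_unit_right => exact .par_unit_right _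

/-- Renaming of variables in formal structure maps. -/
def FormalMap.rename {A : Type u} {B : Type w} (τ : A → B) :
    ∀ {s t : Term A}, FormalMap s t → FormalMap (s.rename τ) (t.rename τ)
  | _, _, .id s => .id (s.rename τ)
  | _, _, .comp f g => (f.rename τ).comp (g.rename τ)
  | _, _, .seq f g => (f.rename τ).seq (g.rename τ)
  | _, _, .par f g => (f.rename τ).par (g.rename τ)
  | _, _, .d x y z w => .d (x.rename τ) (y.rename τ) (z.rename τ) (w.rename τ)
  | _, _, .sym x y => .sym (x.rename τ) (y.rename τ)
  | _, _, .strict h => .strict (h.rename τ)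
  | _, _, .strictInv h => .strictInv (h.rename τ)

/-! ### Heterogeneous equality of morphisms between equal objects -/

section HEq

variable {V : Type u} [Category.{v} V]

theorem comp_heq_comp {X Y Z X' Y' Z' : V} {f : X ⟶ Y} {g : Y ⟶ Z} {f' : X' ⟶ Y'} {g' : Y' ⟶ Z'}
    (hX : X = X') (hY : Y = Y') (hZ : Z = Z') (hf : HEq f f') (hg : HEq g g') :
    HEq (f ≫ g) (f' ≫ g') := by
  subst hX hY hZ; cases hf; cases hg; rfl

theorem id_heq_id {X X' : V} (hX : X = X') : HEq (𝟙 X) (𝟙 X') := by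
  subst hX; rfl

theorem eqToHom_heq_id {X Y : V} (h : X = Y) : HEq (eqToHom h) (𝟙 X) := by
  subst h; rfl

theorem eqToHom_heq_eqToHom {X Y X' Y' : V} (h : X = Y) (h' : X' = Y') (hX : X = X') :
    HEq (eqToHom h) (eqToHom h') := by
  subst hX h h'; rfl

theorem comp_heq_of_left {X Y Z : V} {f : X ⟶ Y} {g : Y ⟶ Z} (h : X = Y) (hf : HEq f (𝟙 X)) :
    HEq (f ≫ g) g := by
  subst h; cases hf; exact heq_of_eq (Category.id_comp g)

theorem comp_heq_of_right {X Y Z : V} {f : X ⟶ Y} {g : Y ⟶ Z} (h : Y = Z) (hg : HEq g (𝟙 Y)) :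
    HEq (f ≫ g) f := by
  subst h; cases hg; exact heq_of_eq (Category.comp_id f)

theorem StrictMonoidal.map_heq_map {I : V} (M : StrictMonoidal V I)
    {X X' Y Y' X₁ X₁' Y₁ Y₁' : V} {f : X ⟶ X'} {g : Y ⟶ Y'} {f₁ : X₁ ⟶ X₁'} {g₁ : Y₁ ⟶ Y₁'}
    (hX : X = X₁) (hX' : X' = X₁') (hY : Y = Y₁) (hY' : Y' = Y₁') (hf : HEq f f₁)
    (hg : HEq g g₁) : HEq (M.map f g) (M.map f₁ g₁) := by
  subst hX hX' hY hY'; cases hf; cases hg; rfl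

end HEq

/-! ### Evaluation under renaming, coherence, and strict equality of terms -/

namespace DuoidalStructure

variable {V : Type u} [Category.{v} V] (D : DuoidalStructure V)

theorem eval_rename {A B : Type*} (τ : A → B) (ρ : B → V) (s : Term A) :
    D.eval ρ (s.rename τ) = D.eval (fun a => ρ (τ a)) s := by
  induction s with
  | unit => rfl
  | atom a => rfl
  | seq s t ihs iht => exact congrArg₂ _ ihs iht
  | par s t ihs iht => exact congrArg₂ _ ihs iht

/-- The function `τ` is arbitrary. Sources and targets agree only propositionally, by `eval_rename`,
hence the heterogeneous equality. -/
theorem evalMap_rename {A B : Type*} (τ : A → B) (ρ : B → V) {s t : Term A} (φ : FormalMap s t) :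
    HEq (D.evalMap ρ (φ.rename τ)) (D.evalMap (fun a => ρ (τ a)) φ) := by
  have e := D.eval_rename τ ρ
  induction φ with
  | id s => exact id_heq_id (e s)
  | comp f g hf hg => exact comp_heq_comp (e _) (e _) (e _) hf hg
  | seq f g hf hg => exact D.seq.map_heq_map (e _) (e _) (e _) (e _) hf hg
  | par f g hf hg => exact D.par.map_heq_map (e _) (e _) (e _) (e _) hf hg
  | d x y z w =>
    change HEq (D.d (D.eval ρ _) (D.eval ρ _) (D.eval ρ _) (D.eval ρ _)) (D.d _ _ _ _)
    rw [e, e, e, e]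
  | sym x y =>
    change HEq (D.sym (D.eval ρ _) (D.eval ρ _)) (D.sym _ _)
    rw [e, e]
  | strict h => exact eqToHom_heq_eqToHom _ _ (e _)
  | strictInv h => exact eqToHom_heq_eqToHom _ _ (e _)

variable {D}

/-- Coherence for formal structure maps in countably many variables. -/
theorem Coherent.evalMap_eq (hD : D.Coherent) {B : Type w} [Countable B] {s t : Term B}
    (hs : s.atoms.Nodup) (φ ψ : FormalMap s t) (ρ : B → V) : D.evalMap ρ φ = D.evalMap ρ ψ := by
  -- `Coherent` speaks of variables in `ℕ`, so the variables are numbered injectively, which keeps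
  -- them distinct. The assignment takes the default value `N` at unused numbers; these do not occur
  -- in the renamed terms.
  obtain ⟨e, he⟩ := exists_injective_nat B
  have hρ : (fun b => Function.extend e ρ (fun _ => D.N) (e b)) = ρ :=
    funext fun b => he.extend_apply ρ _ b
  have h := hD (s.rename e) (t.rename e) (by rw [Term.atoms_rename]; exact hs.map he)
    (φ.rename e) (ψ.rename e) (Function.extend e ρ fun _ => D.N)
  have h1 := D.evalMap_rename e (Function.extend e ρ fun _ => D.N) φ
  have h2 := D.evalMap_rename e (Function.extend e ρ fun _ => D.N) ψ
  rw [hρ] at h1 h2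
  exact eq_of_heq (h1.symm.trans ((heq_of_eq h).trans h2))

variable (D)

/-- Two formal expressions are strictly equal if some formal map between them denotes
identities. -/
def Strictly {A : Type w} (s t : Term A) : Prop :=
  (∀ ρ : A → V, D.eval ρ s = D.eval ρ t) ∧
    ∃ φ : FormalMap s t, ∀ ρ : A → V, HEq (D.evalMap ρ φ) (𝟙 (D.eval ρ s))

namespace Strictly

variable {D} {A : Type w}

theorem refl (s : Term A) : D.Strictly s s := ⟨fun _ => rfl, .id s, fun _ => HEq.rfl⟩

theorem trans {s t r : Term A} : D.Strictly s t → D.Strictly t r → D.Strictly s r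
  | ⟨h, φ, hφ⟩, ⟨h', ψ, hψ⟩ => ⟨fun ρ => (h ρ).trans (h' ρ), φ.comp ψ, fun ρ =>
      (comp_heq_of_right (h' ρ) (hψ ρ)).trans (hφ ρ)⟩

theorem seq {s s' t t' : Term A} : D.Strictly s s' → D.Strictly t t' →
    D.Strictly (s.seq t) (s'.seq t')
  | ⟨h, φ, hφ⟩, ⟨h', ψ, hψ⟩ => ⟨fun ρ => congrArg₂ D.seq.obj (h ρ) (h' ρ), φ.seq ψ, fun ρ =>
      (D.seq.map_heq_map rfl (h ρ).symm rfl (h' ρ).symm (hφ ρ) (hψ ρ)).trans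
        (heq_of_eq (D.seq.map_id _ _))⟩

theorem par {s s' t t' : Term A} : D.Strictly s s' → D.Strictly t t' →
    D.Strictly (s.par t) (s'.par t')
  | ⟨h, φ, hφ⟩, ⟨h', ψ, hψ⟩ => ⟨fun ρ => congrArg₂ D.par.obj (h ρ) (h' ρ), φ.par ψ, fun ρ =>
      (D.par.map_heq_map rfl (h ρ).symm rfl (h' ρ).symm (hφ ρ) (hψ ρ)).trans
        (heq_of_eq (D.par.map_id _ _))⟩

theorem of_pair {s t : Term A} (h : StrictPair s t) : D.Strictly s t ∧ D.Strictly t s :=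
  ⟨⟨fun ρ => D.eval_strict ρ h, .strict h, fun _ => eqToHom_heq_id _⟩,
    fun ρ => (D.eval_strict ρ h).symm, .strictInv h, fun _ => eqToHom_heq_id _⟩

/-- Reduction is a succession of strict associativity and unitality steps, each denoting an
identity. Both directions are carried because a formal map has no formal inverse in general. The
equality of objects contained in `Strictly` later gives preservation of `◁` on objects. -/
theorem seq_seqRed (s t : Term A) :
    D.Strictly (s.seq t) (s.seqRed t) ∧ D.Strictly (s.seqRed t) (s.seq t) := by
  refine Term.seqRed_induction
    (P := fun s t r => D.Strictly (s.seq t) r ∧ D.Strictly r (s.seq t)) ?_ ?_ ?_ ?_ s t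
  · exact fun t => of_pair (.seq_unit_left t)
  · exact fun t => of_pair (.seq_unit_right t)
  · exact fun s s' t _ ih => ⟨(of_pair (.seq_assoc s s' t)).1.trans ((refl s).seq ih.1),
      ((refl s).seq ih.2).trans (of_pair (.seq_assoc s s' t)).2⟩
  · exact fun s t _ _ _ => ⟨refl _, refl _⟩

theorem par_parRed (s t : Term A) :
    D.Strictly (s.par t) (s.parRed t) ∧ D.Strictly (s.parRed t) (s.par t) := by
  refine Term.parRed_induction
    (P := fun s t r => D.Strictly (s.par t) r ∧ D.Strictly r (s.par t)) ?_ ?_ ?_ ?_ s t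
  · exact fun t => of_pair (.par_unit_left t)
  · exact fun t => of_pair (.par_unit_right t)
  · exact fun s s' t _ ih => ⟨(of_pair (.par_assoc s s' t)).1.trans ((refl s).par ih.1),
      ((refl s).par ih.2).trans (of_pair (.par_assoc s s' t)).2⟩
  · exact fun s t _ _ _ => ⟨refl _, refl _⟩

end Strictly

end DuoidalStructure

/-! ### Reduced forms of terms -/

namespace Term

variable {A : Type u} {B : Type w}

/-- The reduced form of a formal expression. -/
def norm : Term A → Term A
  | unit => unit
  | atom a => atom a
  | seq s t => seqRed s.norm t.norm
  | par s t => parRed s.norm t.norm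

theorem norm_rename (τ : A → B) (s : Term A) : (s.rename τ).norm = s.norm.rename τ := by
  induction s with
  | unit => rfl
  | atom a => rfl
  | seq s t ihs iht => rw [rename, norm, norm, rename_seqRed, ihs, iht]
  | par s t ihs iht => rw [rename, norm, norm, rename_parRed, ihs, iht]

theorem norm_of_reduced {s : Term A} (h : s.Reduced) : s.norm = s := by
  induction s with
  | unit => rfl
  | atom a => rfl
  | seq s t ihs iht =>
    obtain ⟨h1, h2, h3, h4, h5⟩ := h
    rw [norm, ihs h1, iht h2, seqRed_of_not h3 h5 h4]
  | par s t ihs iht =>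
    obtain ⟨h1, h2, h3, h4, h5⟩ := h
    rw [norm, ihs h1, iht h2, parRed_of_not h3 h5 h4]

theorem atoms_norm (s : Term A) : s.norm.atoms = s.atoms := by
  induction s with
  | unit => rfl
  | atom a => rfl
  | seq s t ihs iht => rw [norm, (samePoset_seqRed _ _).1, atoms, atoms, ihs, iht]
  | par s t ihs iht => rw [norm, (samePoset_parRed _ _).1, atoms, atoms, ihs, iht]

end Term

/-- Brackets and units are invisible in a strict structure. This lets formulas between arbitrary
terms be compared with formulas between reduced ones, the only terms that expressions provide. -/
theorem DuoidalStructure.strictly_norm {V : Type u} [Category.{v} V] (D : DuoidalStructure V)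
    {A : Type w} (s : Term A) : D.Strictly s s.norm ∧ D.Strictly s.norm s := by
  induction s with
  | unit => exact ⟨.refl _, .refl _⟩
  | atom a => exact ⟨.refl _, .refl _⟩
  | seq s t ihs iht => exact ⟨(ihs.1.seq iht.1).trans (Strictly.seq_seqRed _ _).1,
      (Strictly.seq_seqRed _ _).2.trans (ihs.2.seq iht.2)⟩
  | par s t ihs iht => exact ⟨(ihs.1.par iht.1).trans (Strictly.par_parRed _ _).1,
      (Strictly.par_parRed _ _).2.trans (ihs.2.par iht.2)⟩

/-! ### Strict functors commute with evaluation -/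

namespace PhyDuo.Hom

variable {V W : PhyDuo.{v, u}} (F : Hom V W) {A : Type w}

theorem map_eval (ρ : A → V.carrier) (s : Term A) :
    F.functor.obj (V.str.eval ρ s) = W.str.eval (fun a => F.functor.obj (ρ a)) s := by
  induction s with
  | unit => exact F.obj_N
  | atom a => rfl
  | seq s t ihs iht => exact (F.obj_seq _ _).trans (congrArg₂ _ ihs iht)
  | par s t ihs iht => exact (F.obj_par _ _).trans (congrArg₂ _ ihs iht)

/-- Each constructor of formal maps is preserved by a strict functor. Uniqueness of the extension
comes from here: a functor on values of formulas at singletons is fixed by the images of the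
singletons. -/
theorem map_evalMap (ρ : A → V.carrier) {s t : Term A} (φ : FormalMap s t) :
    HEq (F.functor.map (V.str.evalMap ρ φ)) (W.str.evalMap (fun a => F.functor.obj (ρ a)) φ) := by
  have e := F.map_eval ρ
  have strict : ∀ {X Y : V.carrier} (h : X = Y) {X' Y' : W.carrier} (h' : X' = Y')
      (_ : F.functor.obj X = X'), HEq (F.functor.map (eqToHom h)) (eqToHom h') := by
    rintro X _ rfl _ _ rfl rfl
    exact heq_of_eq (F.functor.map_id X)
  induction φ with
  | id s => exact (heq_of_eq (F.functor.map_id _)).trans (id_heq_id (e s))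
  | comp f g hf hg =>
    exact (heq_of_eq (F.functor.map_comp _ _)).trans (comp_heq_comp (e _) (e _) (e _) hf hg)
  | seq f g hf hg =>
    exact (F.map_seq _ _).trans (W.str.seq.map_heq_map (e _) (e _) (e _) (e _) hf hg)
  | par f g hf hg =>
    exact (F.map_par _ _).trans (W.str.par.map_heq_map (e _) (e _) (e _) (e _) hf hg)
  | d x y z w =>
    refine (F.map_d _ _ _ _).trans ?_
    rw [e, e, e, e]
    rfl
  | sym x y =>
    refine (F.map_sym _ _).trans ?_
    rw [e, e]
    rfl
  | strict h => exact strict _ _ (e _)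
  | strictInv h => exact strict _ _ (e _)

end PhyDuo.Hom

/-! ### Terms with prescribed variables at the leaves -/

namespace Term

variable {A : Type u} {B : Type w}

/-- The expression of the same shape in which each leaf carries the given variable. -/
def decorate : (t : Term A) → (t.encode.carrier → B) → Term B
  | unit, _ => unit
  | atom _, q => atom (q ())
  | seq s t, q => seq (s.decorate fun x => q (.inl x)) (t.decorate fun x => q (.inr x))
  | par s t, q => par (s.decorate fun x => q (.inl x)) (t.decorate fun x => q (.inr x))

theorem rename_decorate {C : Type v} (t : Term A) (q : t.encode.carrier → B) (σ : B → C) :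
    (t.decorate q).rename σ = t.decorate fun x => σ (q x) := by
  induction t with
  | unit => rfl
  | atom a => rfl
  | seq s t ihs iht | par s t ihs iht => rw [decorate, rename, ihs, iht]; rfl

theorem decorate_label (t : Term A) : t.decorate t.encode.label = t := by
  induction t with
  | unit => rfl
  | atom a => rfl
  | seq s t ihs iht => exact congrArg₂ seq ihs iht
  | par s t ihs iht => exact congrArg₂ par ihs iht

theorem mem_atoms_decorate {t : Term A} {q : t.encode.carrier → B} {b : B} :
    b ∈ (t.decorate q).atoms ↔ ∃ x, q x = b := by
  induction t with
  | unit => exact iff_of_false (by simp [decorate, atoms]) fun ⟨x, _⟩ => x.elim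
  | atom a =>
    refine List.mem_singleton.trans ⟨fun h => ⟨(), h.symm⟩, ?_⟩
    rintro ⟨⟨⟩, h⟩
    exact h.symm
  | seq s t ihs iht | par s t ihs iht =>
    exact List.mem_append.trans ((or_congr ihs iht).trans
      (Sum.exists (p := fun x => q x = b)).symm)

theorem nodup_decorate {t : Term A} {q : t.encode.carrier → B} (hq : q.Injective) :
    (t.decorate q).atoms.Nodup := by
  induction t with
  | unit => exact List.nodup_nil
  | atom a => exact List.nodup_singleton _
  | seq s t ihs iht | par s t ihs iht =>
    refine List.nodup_append.mpr ⟨ihs (hq.comp Sum.inl_injective),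
      iht (hq.comp Sum.inr_injective), fun a ha b hb e => ?_⟩
    obtain ⟨x, rfl⟩ := mem_atoms_decorate.mp ha
    obtain ⟨y, rfl⟩ := mem_atoms_decorate.mp hb
    exact Sum.inl_ne_inr (hq e)

theorem length_atoms_decorate (t : Term A) (q : t.encode.carrier → B) :
    (t.decorate q).atoms.length = t.size := by
  induction t with
  | unit => rfl
  | atom a => rfl
  | seq s t ihs iht | par s t ihs iht =>
    exact List.length_append.trans (congrArg₂ _ (ihs _) (iht _))

theorem atoms_decorate_getElem? (t : Term A) (q : t.encode.carrier → B) (x : t.encode.carrier) :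
    (t.decorate q).atoms[t.pos x]? = some (q x) := by
  induction t with
  | unit => exact x.elim
  | atom a => rfl
  | seq s t ihs iht | par s t ihs iht =>
    rcases x with x | x
    · change (_ ++ _)[s.pos x]? = _
      rw [List.getElem?_append_left (by rw [length_atoms_decorate]; exact s.pos_lt x), ihs]
    · change (_ ++ _)[s.size + t.pos x]? = _
      rw [List.getElem?_append_right (by rw [length_atoms_decorate]; omega), length_atoms_decorate,
        Nat.add_sub_cancel_left, iht]

/-- A term is recovered from its shape and the list of its variables. -/
theorem decorate_rename_eq (σ : B → A) (u : Term B) (q : (u.rename σ).encode.carrier → B)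
    (h : ∀ x, u.atoms[(u.rename σ).pos x]? = some (q x)) : (u.rename σ).decorate q = u := by
  induction u with
  | unit => rfl
  | atom b => exact congrArg atom (Option.some.inj (h ())).symm
  | seq s t ihs iht | par s t ihs iht =>
    refine congrArg₂ _ (ihs _ fun x => ?_) (iht _ fun x => ?_)
    · refine Eq.trans ?_ (h (.inl x))
      change _ = (s.atoms ++ t.atoms)[(s.rename σ).pos x]?
      rw [List.getElem?_append_left]
      rw [length_atoms, ← size_rename σ s]
      exact pos_lt _ x
    · refine Eq.trans ?_ (h (.inr x))
      change _ = (s.atoms ++ t.atoms)[(s.rename σ).size + (t.rename σ).pos x]?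
      rw [List.getElem?_append_right (by rw [length_atoms, size_rename]; omega), length_atoms,
        size_rename, Nat.add_sub_cancel_left]

/-- The comparison is made on leaves because `q` may identify some of them. For injective `q` the
order on variables is the strict order of the poset, transported. -/
theorem rel_decorate {t : Term A} {q : t.encode.carrier → B} {a b : B} :
    (t.decorate q).rel a b ↔ ∃ x y, (t.encode.le x y ∧ x ≠ y) ∧ q x = a ∧ q y = b := by
  induction t with
  | unit => exact iff_of_false id fun ⟨x, _⟩ => x.elim
  | atom c => exact iff_of_false id fun ⟨_, _, h, _⟩ => h.2 rfl
  | seq s t ihs iht =>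
    simp only [decorate, rel, ihs, iht, mem_atoms_decorate]
    constructor
    · rintro (⟨x, y, h, e⟩ | ⟨x, y, h, e⟩ | ⟨⟨x, hx⟩, ⟨y, hy⟩⟩)
      · exact ⟨.inl x, .inl y, ⟨.inl h.1, fun e => h.2 (Sum.inl_injective e)⟩, e⟩
      · exact ⟨.inr x, .inr y, ⟨.inr h.1, fun e => h.2 (Sum.inr_injective e)⟩, e⟩
      · exact ⟨.inl x, .inr y, ⟨.sep _ _, Sum.inl_ne_inr⟩, hx, hy⟩
    · rintro ⟨x, y, ⟨h | h | _, hne⟩, e⟩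
      · exact .inl ⟨_, _, ⟨h, fun e => hne (congrArg _ e)⟩, e⟩
      · exact .inr (.inl ⟨_, _, ⟨h, fun e => hne (congrArg _ e)⟩, e⟩)
      · exact .inr (.inr ⟨⟨_, e.1⟩, ⟨_, e.2⟩⟩)
  | par s t ihs iht =>
    simp only [decorate, rel, ihs, iht]
    constructor
    · rintro (⟨x, y, h, e⟩ | ⟨x, y, h, e⟩)
      · exact ⟨.inl x, .inl y, ⟨.inl h.1, fun e => h.2 (Sum.inl_injective e)⟩, e⟩
      · exact ⟨.inr x, .inr y, ⟨.inr h.1, fun e => h.2 (Sum.inr_injective e)⟩, e⟩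
    · rintro ⟨x, y, ⟨h | h, hne⟩, e⟩
      · exact .inl ⟨_, _, ⟨h, fun e => hne (congrArg _ e)⟩, e⟩
      · exact .inr ⟨_, _, ⟨h, fun e => hne (congrArg _ e)⟩, e⟩

/-- Every inclusion of posets is denoted by a formal structure map between expressions without
repeated variables. -/
theorem reach_decorate {s t : Term A} (g : ZetlessPoset.Inclusion.{v} s.encode t.encode)
    {e : s.encode.carrier → B} (he : e.Injective) :
    Reach (s.decorate e) (t.decorate fun y => e (g.equiv.symm y)) := by
  -- Each leaf of `t` carries the variable of its preimage under `g`. The variables are therefore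
  -- the same on both sides, and monotonicity and injectivity of `g` give the inclusion of strict
  -- orders.
  refine Reach.of_rel (nodup_decorate he) (nodup_decorate (he.comp g.equiv.symm.injective)) ?_ ?_
  · intro b
    rw [mem_atoms_decorate, mem_atoms_decorate]
    exact (g.equiv.symm.surjective.exists (p := fun x => e x = b))
  · intro a b h
    obtain ⟨x, y, ⟨hle, hne⟩, hx, hy⟩ := rel_decorate.mp h
    exact rel_decorate.mpr ⟨g.equiv x, g.equiv y, ⟨g.le _ _ hle, fun h => hne (g.equiv.injective h)⟩,
      by simpa using hx, by simpa using hy⟩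

end Term

/-! ### Formulas evaluated in the category of zetless maps -/

namespace Expr

variable {A : Type u} {B : Type}

/-- The value of a formal expression in the category of zetless maps, the variables being replaced
by singletons. -/
noncomputable def value (σ : B → A) (s : Term B) : Expr A := (duoidal.{v} A).eval (fun b => atom (σ b)) s

/-- Evaluation among expressions reduces at every node, exactly as `norm` does, and reduction
commutes with relabelling. -/
theorem term_value (σ : B → A) (s : Term B) : (value.{v} σ s).term = s.norm.rename σ := by
  induction s with
  | unit => rfl
  | atom b => rfl
  | seq s t ihs iht => rw [Term.norm, Term.rename_seqRed, ← ihs, ← iht]; rfl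
  | par s t ihs iht => rw [Term.norm, Term.rename_parRed, ← ihs, ← iht]; rfl

theorem value_of_rename {σ : B → A} {s : Term B} {E : Expr A} (h : s.rename σ = E.term) :
    value.{v} σ s = E :=
  Expr.ext (by rw [term_value, ← Term.norm_rename, h, Term.norm_of_reduced E.reduced])

theorem size_value (σ : B → A) (s : Term B) : (value.{v} σ s).size = s.atoms.length := by
  rw [size, term_value, Term.size_rename, ← Term.length_atoms, Term.atoms_norm]

/-- The value of a formal structure map in the category of zetless maps, the variables being
replaced by singletons. -/
noncomputable def valueMap (σ : B → A) {s t : Term B} (φ : FormalMap s t) :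
    Map.{v} (value.{v} σ s) (value.{v} σ t) :=
  (duoidal.{v} A).evalMap (fun b => atom (σ b)) φ

/-- Structure maps move leaves together with their variables: the generators act by block exchanges
or trivially, and the operations by blocks or composition. What is followed is the variable in `B`,
not its label in `A`, so `σ` may identify variables and the action is still determined when `t` has
no repetition. -/
theorem atoms_valueMap (σ : B → A) {s t : Term B} (φ : FormalMap s t) (i : ℕ) :
    t.atoms[act (valueMap.{v} σ φ) i]? = s.atoms[i]? := by
  induction φ generalizing i with
  | id s => exact congrArg (fun p : ℕ → ℕ => s.atoms[p i]?) (act_id.{v} _)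
  | comp f g hf hg =>
    refine Eq.trans ?_ ((hg _).trans (hf i))
    exact congrArg (fun p : ℕ → ℕ => _[p i]?) (act_comp.{v} (valueMap σ f) (valueMap σ g))
  | @seq s s' t t' f g hf hg =>
    change (_ ++ _)[act (seqMap _ _) i]? = (_ ++ _)[i]?
    rw [act_seqMap]
    refine block_getElem? (size_value _ _).symm ?_ (actsOn _) hf hg i
    rw [← size_value.{v} σ]
    exact (size_eq (valueMap σ f)).symm
  | @par s s' t t' f g hf hg =>
    change (_ ++ _)[act (parMap _ _) i]? = (_ ++ _)[i]?
    rw [act_parMap]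
    refine block_getElem? (size_value _ _).symm ?_ (actsOn _) hf hg i
    rw [← size_value.{v} σ]
    exact (size_eq (valueMap σ f)).symm
  | d x y z w =>
    change ((_ ++ _) ++ (_ ++ _))[act (dMap (value σ x) (value σ y) (value σ z) (value σ w)) i]? =
      ((_ ++ _) ++ (_ ++ _))[i]?
    rw [act_dMap, size_value, size_value, size_value]
    exact mid_getElem? _ _ _ _ i
  | sym x y =>
    change (_ ++ _)[act (symMap (value σ x) (value σ y)) i]? = (_ ++ _)[i]?
    rw [act_symMap, size_value, size_value]
    simpa using swap_getElem? x.atoms y.atoms [] i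
  | @strict s t h =>
    have e : act (valueMap.{v} σ (.strict h)) = id :=
      act_eqToHom ((DuoidalStructure.eval_strict _ _ h))
    rw [e, (Term.samePoset_of_strictPair h).1]; rfl
  | @strictInv s t h =>
    have e : act (valueMap.{v} σ (.strictInv h)) = id :=
      act_eqToHom (((DuoidalStructure.eval_strict _ _ h).symm))
    rw [e, (Term.samePoset_of_strictPair h).1]; rfl

/-- Every zetless map is the value of a formal structure map between expressions without repeated
variables. -/
theorem exists_formalMap {E F : Expr A} (g : Map.{v} E F) (e : E.term.encode.carrier → B)
    (he : e.Injective) (σ : B → A) (hσ : ∀ x, σ (e x) = E.term.encode.label x) :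
    value.{v} σ (E.term.decorate e) = E ∧
    value.{v} σ (F.term.decorate fun y => e (g.equiv.symm y)) = F ∧
    ∃ φ : FormalMap (E.term.decorate e) (F.term.decorate fun y => e (g.equiv.symm y)),
      HEq (valueMap σ φ) g := by
  obtain ⟨φ⟩ := Term.reach_decorate g he
  have h1 : value.{v} σ (E.term.decorate e) = E := value_of_rename (by
    rw [Term.rename_decorate]
    simp only [hσ, Term.decorate_label])
  have h2 : value.{v} σ (F.term.decorate fun y => e (g.equiv.symm y)) = F := value_of_rename (by
    rw [Term.rename_decorate]
    have : ∀ y, E.term.encode.label (g.equiv.symm y) = F.term.encode.label y := fun y => by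
      rw [← g.label, Equiv.apply_symm_apply]
    simp only [hσ, this, Term.decorate_label])
  refine ⟨h1, h2, φ, hom_heq h1 h2 (funext fun i => ?_)⟩
  rcases lt_or_ge i E.size with hi | hi
  · have hn := Term.nodup_decorate (he.comp g.equiv.symm.injective)
    -- Both actions send the position of the leaf `x` to a position of the target occupied by the
    -- variable `e x`; without repetitions there is only one.
    obtain ⟨x, rfl⟩ := E.term.exists_pos hi
    refine (List.getElem?_inj ?_ hn).mp ((atoms_valueMap σ φ _).trans ?_)
    · rw [Term.length_atoms_decorate]
      exact ((actsOn _).lt (by rwa [h1])).trans_eq ((congrArg size h1).trans (size_eq g))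
    · refine (Term.atoms_decorate_getElem? _ _ x).trans (Eq.trans ?_
        (congrArg _ (Term.act_pos E.term F.term g x)).symm)
      refine Eq.trans ?_ (Term.atoms_decorate_getElem? F.term _ (g.equiv x)).symm
      exact congrArg some (congrArg e (g.equiv.symm_apply_apply x).symm)
  · rw [(actsOn g).eq hi, (actsOn (valueMap σ φ)).eq (by rwa [h1])]

end Expr

/-- The type of `q` depends on `T`. Keeping `T` a variable allows use with the term of an
expression, which is only propositionally a renaming. -/
theorem Term.decorate_eq_of_eq_rename {A : Type u} {B : Type w} {σ : B → A} {u : Term B} {T : Term A}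
    (hT : T = u.rename σ) {q : T.encode.carrier → B}
    (h : ∀ x, u.atoms[T.pos x]? = some (q x)) : T.decorate q = u := by
  subst hT
  exact Term.decorate_rename_eq σ u q h

theorem DuoidalStructure.exists_evalMap_heq {V : Type u} [Category.{v} V] (D : DuoidalStructure V)
    {B : Type w} (ρ : B → V) {s t s' t' : Term B} (hs : s' = s) (ht : t' = t)
    (φ : FormalMap s' t') : ∃ ψ : FormalMap s t, HEq (D.evalMap ρ ψ) (D.evalMap ρ φ) := by
  subst hs ht
  exact ⟨φ, HEq.rfl⟩

/-! ### Values of zetless maps in a strict physical duoidal category -/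

namespace Expr

variable {A : Type u} (V : PhyDuo.{v, u}) (f : A → V.carrier)

/-- The value of a duoidal expression in a strict physical duoidal category. -/
def freeObj (E : Expr A) : V.carrier := V.str.eval f E.term

/-- Evaluating first among expressions only reduces the term, and `V` does not see reduction. -/
theorem freeObj_value {B : Type} (σ : B → A) (s : Term B) :
    freeObj V f (value.{v} σ s) = V.str.eval (fun b => f (σ b)) s := by
  rw [freeObj, term_value, DuoidalStructure.eval_rename]
  exact ((V.str.strictly_norm s).1.1 _).symm

variable {V f}

/-- A formal structure map denoting a given zetless map, its variables being the leaves of the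
source. -/
noncomputable def formal {E F : Expr A} (g : Map.{v} E F) :
    FormalMap (E.term.decorate fun x => x) (F.term.decorate fun y => g.equiv.symm y) :=
  (exists_formalMap g (fun x => x) Function.injective_id _ fun _ => rfl).2.2.choose

theorem value_source (E : Expr A) :
    value.{v} E.term.encode.label (E.term.decorate fun x => x) = E :=
  (exists_formalMap (𝟙 E) (fun x => x) Function.injective_id _ fun _ => rfl).1

theorem value_target {E F : Expr A} (g : Map.{v} E F) :
    value.{v} E.term.encode.label (F.term.decorate fun y => g.equiv.symm y) = F :=
  (exists_formalMap g (fun x => x) Function.injective_id _ fun _ => rfl).2.1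

theorem valueMap_formal {E F : Expr A} (g : Map.{v} E F) :
    HEq (valueMap E.term.encode.label (formal g)) g :=
  (exists_formalMap g (fun x => x) Function.injective_id _ fun _ => rfl).2.2.choose_spec

theorem nodup_source (E : Expr A) : (E.term.decorate fun x => x).atoms.Nodup :=
  Term.nodup_decorate Function.injective_id

variable (V f)

/-- The value of a zetless map in a strict physical duoidal category. -/
noncomputable def freeMap {E F : Expr A} (g : Map.{v} E F) : freeObj V f E ⟶ freeObj V f F :=
  eqToHom ((congrArg _ (value_source E)).symm.trans (freeObj_value V f _ _)) ≫
    V.str.evalMap (fun x => f (E.term.encode.label x)) (formal g) ≫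
    eqToHom ((freeObj_value V f _ _).symm.trans (congrArg _ (value_target g)))

theorem freeMap_heq_formal {E F : Expr A} (g : Map.{v} E F) :
    HEq (freeMap V f g) (V.str.evalMap (fun x => f (E.term.encode.label x)) (formal g)) := by
  rw [freeMap, eqToHom_comp_heq_iff, comp_eqToHom_heq_iff]

/-- Every formal structure map without repeated variables denoting a zetless map computes its value
in a strict physical duoidal category. -/
theorem freeMap_heq {B : Type} [Countable B] {s t : Term B} (hs : s.atoms.Nodup) (σ : B → A)
    (φ : FormalMap s t) {E F : Expr A} {g : Map.{v} E F} (hE : value.{v} σ s = E)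
    (hF : value.{v} σ t = F) (hg : HEq g (valueMap σ φ)) :
    HEq (freeMap V f g) (V.str.evalMap (fun b => f (σ b)) φ) := by
  refine (freeMap_heq_formal V f g).trans ?_
  have hact : act g = act (valueMap.{v} σ φ) := act_heq hE.symm hF.symm hg
  have hE' : E.term = s.norm.rename σ := by rw [← hE, term_value]
  have hF' : F.term = t.norm.rename σ := by rw [← hF, term_value]
  have hex : ∀ x : E.term.encode.carrier, ∃ b, s.norm.atoms[E.term.pos x]? = some b := fun x => by
    have hx : E.term.pos x < s.norm.atoms.length := by
      rw [Term.atoms_norm, ← size_value.{v} σ s, hE]; exact E.term.pos_lt x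
    exact ⟨_, List.getElem?_eq_getElem hx⟩
  -- Up to labels, `E` is the reduced form of `s`; `τ` reads off the variable of `s` at the position
  -- of each leaf of `E`. It serves to rename the canonical formula `formal g` into the variables of
  -- `φ`.
  choose τ hτ using hex
  have hτ' : ∀ x, E.term.encode.label x = σ (τ x) := fun x => by
    apply Option.some.inj
    have ha : E.term.atoms = s.norm.atoms.map σ := by rw [hE', Term.atoms_rename]
    rw [← Term.atoms_getElem?, ha, List.getElem?_map, hτ]
    rfl
  have h1 : (E.term.decorate fun x => x).rename τ = s.norm := by
    rw [Term.rename_decorate]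
    exact Term.decorate_eq_of_eq_rename hE' hτ
  -- At the target the leaf `g x` receives the variable `τ x`. Since `g` acts as the value of `φ`,
  -- which respects variables, that is the variable of `t` at the position of `g x`.
  have h2 : (F.term.decorate fun y => g.equiv.symm y).rename τ = t.norm := by
    rw [Term.rename_decorate]
    refine Term.decorate_eq_of_eq_rename hF' fun y => ?_
    obtain ⟨x, rfl⟩ := g.equiv.surjective y
    have e1 := Term.act_pos E.term F.term g x
    have e2 := atoms_valueMap.{v} σ φ (E.term.pos x)
    rw [← hact] at e2
    rw [Equiv.symm_apply_apply, Term.atoms_norm, ← e1, ← hτ x, Term.atoms_norm]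
    exact e2
  obtain ⟨ψ, hψ⟩ := V.str.exists_evalMap_heq (fun b => f (σ b)) h1 h2 ((formal g).rename τ)
  -- Framed by `α` from `s` to its reduced form and `β` from the reduced form to `t`, the renamed
  -- canonical formula is parallel to `φ`. Coherence equates the two, and `α` and `β` contribute
  -- identities.
  obtain ⟨hs1, α, hα⟩ := (V.str.strictly_norm s).1
  obtain ⟨ht1, β, hβ⟩ := (V.str.strictly_norm t).2
  rw [V.coherent.evalMap_eq hs φ (α.comp (ψ.comp β))]
  have e1 : HEq (V.str.evalMap (fun b => f (σ b)) ((formal g).rename τ))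
      (V.str.evalMap (fun x => f (σ (τ x))) (formal g)) := V.str.evalMap_rename τ _ _
  rw [← funext fun x => congrArg f (hτ' x)] at e1
  refine e1.symm.trans (hψ.symm.trans ?_)
  exact ((comp_heq_of_left (hs1 _) (hα _)).trans (comp_heq_of_right (ht1 _) (hβ _))).symm

/-- Allows free choice of the variables through `e`, so that formulas for several zetless maps can
be written over one set of variables and then composed, sequenced or tensored. -/
theorem exists_formalMap_heq {B : Type} [Countable B] {E F : Expr A} (g : Map.{v} E F)
    (e : E.term.encode.carrier → B) (he : e.Injective) (σ : B → A)
    (hσ : ∀ x, σ (e x) = E.term.encode.label x) :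
    ∃ φ : FormalMap (E.term.decorate e) (F.term.decorate fun y => e (g.equiv.symm y)),
      HEq (valueMap σ φ) g ∧ HEq (V.str.evalMap (fun b => f (σ b)) φ) (freeMap V f g) := by
  obtain ⟨h1, h2, φ, hφ⟩ := exists_formalMap g e he σ hσ
  exact ⟨φ, hφ, (freeMap_heq V f (Term.nodup_decorate he) σ φ h1 h2 hφ.symm).symm⟩

end Expr

/-- Gives the countability that coherence asks for when leaves serve as variables. -/
instance {A : Type u} (P : ZetlessPoset A) : Finite P.carrier := P.finite

theorem DuoidalStructure.evalMap_congr {V : Type u} [Category.{v} V] (D : DuoidalStructure V)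
    {B : Type w} {ρ ρ' : B → V} (h : ρ = ρ') {s t : Term B} (φ : FormalMap s t) :
    HEq (D.evalMap ρ φ) (D.evalMap ρ' φ) := by
  subst h; rfl

/-! ### Functoriality and preservation of the structure -/

namespace Expr

variable {A : Type u}

theorem value_decorate {B : Type} {σ : B → A} {E : Expr A} {e : E.term.encode.carrier → B}
    (hσ : ∀ x, σ (e x) = E.term.encode.label x) : value.{v} σ (E.term.decorate e) = E :=
  value_of_rename (by rw [Term.rename_decorate]; simp only [hσ, Term.decorate_label])

theorem label_equiv_symm {E F : Expr A} (g : Map.{v} E F) (y : F.term.encode.carrier) :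
    E.term.encode.label (g.equiv.symm y) = F.term.encode.label y := by
  rw [← g.label, Equiv.apply_symm_apply]

variable (V : PhyDuo.{v, u}) (f : A → V.carrier)

theorem eval_decorate {B : Type} {σ : B → A} {E : Expr A} {e : E.term.encode.carrier → B}
    (hσ : ∀ x, σ (e x) = E.term.encode.label x) :
    V.str.eval (fun b => f (σ b)) (E.term.decorate e) = freeObj V f E := by
  rw [← freeObj_value, value_decorate hσ]

theorem freeMap_id (E : Expr A) : freeMap V f (𝟙 E) = 𝟙 (freeObj V f E) :=
  eq_of_heq ((freeMap_heq V f (nodup_source E) E.term.encode.label (.id _) (value_source E)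
    (value_source E) (id_heq_id (value_source E).symm)).trans
      (id_heq_id (eval_decorate V f fun _ => rfl)))

theorem freeMap_comp {E F G : Expr A} (g : Map.{v} E F) (h : Map.{v} F G) :
    freeMap V f (g ≫ h) = freeMap V f g ≫ freeMap V f h := by
  have hF := label_equiv_symm g
  have hG : ∀ z, E.term.encode.label (g.equiv.symm (h.equiv.symm z)) = G.term.encode.label z :=
    fun z => (hF _).trans (label_equiv_symm h z)
  obtain ⟨φ, h1, h2⟩ := exists_formalMap_heq V f g (fun x => x) Function.injective_id
    E.term.encode.label fun _ => rfl
  -- The leaves of `F` are named by their preimages in `E`, so that `ψ` starts at the target of `φ`;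
  -- `φ.comp ψ` is then a formula for `g ≫ h`.
  obtain ⟨ψ, h3, h4⟩ := exists_formalMap_heq V f h (fun y => g.equiv.symm y)
    g.equiv.symm.injective E.term.encode.label hF
  have hE := value_source.{v} E
  have hF' := value_decorate.{v} hF
  have hG' := value_decorate.{v} hG
  refine eq_of_heq ((freeMap_heq V f (nodup_source E) E.term.encode.label (φ.comp ψ) hE hG'
    (comp_heq_comp hE hF' hG' h1 h3).symm).trans ?_)
  exact comp_heq_comp (eval_decorate V f fun _ => rfl) (eval_decorate V f hF)
    (eval_decorate V f hG) h2 h4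

theorem freeMap_seqMap {E E' F F' : Expr A} (g : Map.{v} E E') (h : Map.{v} F F') :
    HEq (freeMap V f (seqMap g h)) (V.str.seq.map (freeMap V f g) (freeMap V f h)) := by
  -- The variables are the disjoint union of the leaves of the two sources, so that `φ.seq ψ` has no
  -- repeated variable even when labels coincide.
  let σ := Sum.elim E.term.encode.label F.term.encode.label
  have hE' : ∀ y, σ (.inl (g.equiv.symm y)) = E'.term.encode.label y :=
    label_equiv_symm g
  have hF' : ∀ y, σ (.inr (h.equiv.symm y)) = F'.term.encode.label y :=
    label_equiv_symm h
  obtain ⟨φ, h1, h2⟩ := exists_formalMap_heq V f g Sum.inl Sum.inl_injective σ fun _ => rfl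
  obtain ⟨ψ, h3, h4⟩ := exists_formalMap_heq V f h Sum.inr Sum.inr_injective σ fun _ => rfl
  have e1 : value.{v} σ (E.term.decorate Sum.inl) = E := value_decorate fun _ => rfl
  have e2 : value.{v} σ (F.term.decorate Sum.inr) = F := value_decorate fun _ => rfl
  have e3 := value_decorate.{v} hE'
  have e4 := value_decorate.{v} hF'
  have hn := Term.nodup_decorate (t := E.term.seq F.term) Function.injective_id
  refine (freeMap_heq V f hn σ (φ.seq ψ) (congrArg₂ seq e1 e2) (congrArg₂ seq e3 e4)
    ((seqMonoidal A).map_heq_map e1 e3 e2 e4 h1 h3).symm).trans ?_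
  exact V.str.seq.map_heq_map (eval_decorate V f fun _ => rfl) (eval_decorate V f hE')
    (eval_decorate V f fun _ => rfl) (eval_decorate V f hF') h2 h4

theorem freeMap_parMap {E E' F F' : Expr A} (g : Map.{v} E E') (h : Map.{v} F F') :
    HEq (freeMap V f (parMap g h)) (V.str.par.map (freeMap V f g) (freeMap V f h)) := by
  -- As for sequencing, disjoint sets of leaves keep the variables of `φ.par ψ` distinct.
  let σ := Sum.elim E.term.encode.label F.term.encode.label
  have hE' : ∀ y, σ (.inl (g.equiv.symm y)) = E'.term.encode.label y :=
    label_equiv_symm g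
  have hF' : ∀ y, σ (.inr (h.equiv.symm y)) = F'.term.encode.label y :=
    label_equiv_symm h
  obtain ⟨φ, h1, h2⟩ := exists_formalMap_heq V f g Sum.inl Sum.inl_injective σ fun _ => rfl
  obtain ⟨ψ, h3, h4⟩ := exists_formalMap_heq V f h Sum.inr Sum.inr_injective σ fun _ => rfl
  have e1 : value.{v} σ (E.term.decorate Sum.inl) = E := value_decorate fun _ => rfl
  have e2 : value.{v} σ (F.term.decorate Sum.inr) = F := value_decorate fun _ => rfl
  have e3 := value_decorate.{v} hE'
  have e4 := value_decorate.{v} hF'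
  have hn := Term.nodup_decorate (t := E.term.par F.term) Function.injective_id
  refine (freeMap_heq V f hn σ (φ.par ψ) (congrArg₂ par e1 e2) (congrArg₂ par e3 e4)
    ((parMonoidal A).map_heq_map e1 e3 e2 e4 h1 h3).symm).trans ?_
  exact V.str.par.map_heq_map (eval_decorate V f fun _ => rfl) (eval_decorate V f hE')
    (eval_decorate V f fun _ => rfl) (eval_decorate V f hF') h2 h4

theorem freeMap_symMap (E F : Expr A) :
    HEq (freeMap V f (symMap E F)) (V.str.sym (freeObj V f E) (freeObj V f F)) := by
  -- The leaves of the unreduced tensoring are the variables, and the symmetry itself is the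
  -- formula. The reduced term of `E.par F` would not split syntactically into `E` and `F`.
  let T := E.term.par F.term
  let σ := T.encode.label
  let x : Term T.encode.carrier := E.term.decorate fun i => .inl i
  let y : Term T.encode.carrier := F.term.decorate fun i => .inr i
  have e1 : value.{v} σ x = E := value_decorate fun _ => rfl
  have e2 : value.{v} σ y = F := value_decorate fun _ => rfl
  have o1 : V.str.eval (fun b => f (σ b)) x = _ := eval_decorate V f fun _ => rfl
  have o2 : V.str.eval (fun b => f (σ b)) y = _ := eval_decorate V f fun _ => rfl
  have hn : (x.par y).atoms.Nodup := Term.nodup_decorate (t := T) Function.injective_id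
  refine (freeMap_heq V f hn σ (.sym x y) (congrArg₂ par e1 e2) (congrArg₂ par e2 e1)
    (by change HEq _ (symMap.{v} (value σ x) (value σ y)); rw [e1, e2])).trans ?_
  change HEq (V.str.sym (V.str.eval _ x) (V.str.eval _ y)) _
  rw [o1, o2]

theorem freeMap_dMap (X Y Z W : Expr A) : HEq (freeMap V f (dMap X Y Z W))
    (V.str.d (freeObj V f X) (freeObj V f Y) (freeObj V f Z) (freeObj V f W)) := by
  -- The unreduced source of the distributor supplies four disjoint sets of variables.
  let T := (X.term.seq Z.term).par (Y.term.seq W.term)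
  let σ := T.encode.label
  let x : Term T.encode.carrier := X.term.decorate fun i => .inl (.inl i)
  let y : Term T.encode.carrier := Y.term.decorate fun i => .inr (.inl i)
  let z : Term T.encode.carrier := Z.term.decorate fun i => .inl (.inr i)
  let w : Term T.encode.carrier := W.term.decorate fun i => .inr (.inr i)
  have e1 : value.{v} σ x = X := value_decorate fun _ => rfl
  have e2 : value.{v} σ y = Y := value_decorate fun _ => rfl
  have e3 : value.{v} σ z = Z := value_decorate fun _ => rfl
  have e4 : value.{v} σ w = W := value_decorate fun _ => rfl
  have o1 : V.str.eval (fun b => f (σ b)) x = _ := eval_decorate V f fun _ => rfl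
  have o2 : V.str.eval (fun b => f (σ b)) y = _ := eval_decorate V f fun _ => rfl
  have o3 : V.str.eval (fun b => f (σ b)) z = _ := eval_decorate V f fun _ => rfl
  have o4 : V.str.eval (fun b => f (σ b)) w = _ := eval_decorate V f fun _ => rfl
  have hn : ((x.seq z).par (y.seq w)).atoms.Nodup :=
    Term.nodup_decorate (t := T) Function.injective_id
  refine (freeMap_heq V f hn σ (.d x y z w)
    (congrArg₂ par (congrArg₂ seq e1 e3) (congrArg₂ seq e2 e4))
    (congrArg₂ seq (congrArg₂ par e1 e2) (congrArg₂ par e3 e4))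
    (by change HEq _ (dMap.{v} (value σ x) (value σ y) (value σ z) (value σ w))
        rw [e1, e2, e3, e4])).trans ?_
  change HEq (V.str.d (V.str.eval _ x) (V.str.eval _ y) (V.str.eval _ z) (V.str.eval _ w)) _
  rw [o1, o2, o3, o4]

end Expr

/-! ### The universal property and the adjunction -/

/-- The strict physical duoidal functor out of the category of zetless maps extending a
function. -/
noncomputable def freeHom {A : Type u} (V : PhyDuo.{v, u}) (f : A → V.carrier) :
    PhyDuo.Hom (zetless.{v, u} A) V where
  functor :=
    { obj := Expr.freeObj V f
      map := Expr.freeMap V f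
      map_id := Expr.freeMap_id V f
      map_comp := Expr.freeMap_comp V f }
  obj_N := rfl
  obj_seq _ _ := (DuoidalStructure.Strictly.seq_seqRed _ _).2.1 f
  obj_par _ _ := (DuoidalStructure.Strictly.par_parRed _ _).2.1 f
  map_seq := Expr.freeMap_seqMap V f
  map_par := Expr.freeMap_parMap V f
  map_sym := Expr.freeMap_symMap V f
  map_d := Expr.freeMap_dMap V f

/-- A strict physical duoidal functor out of the category of zetless maps is determined by the
images of the singletons. -/
theorem eq_freeHom {A : Type u} (V : PhyDuo.{v, u}) (f : A → V.carrier)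
    (G : PhyDuo.Hom (zetless.{v, u} A) V) (hG : ∀ a, G.functor.obj (Expr.atom a) = f a) :
    G = freeHom V f := by
  have hρ : ∀ E : Expr A, (fun x => G.functor.obj (Expr.atom (E.term.encode.label x))) =
      fun x => f (E.term.encode.label x) := fun E => funext fun _ => hG _
  -- Every expression is the value of a term at singletons, and `G` commutes with evaluation.
  have hobj : ∀ E : Expr A, G.functor.obj E = Expr.freeObj V f E := fun E => by
    have h := G.map_eval (fun b => Expr.atom (E.term.encode.label b))
      (E.term.decorate fun x => x)
    rw [hρ, Expr.eval_decorate V f fun _ => rfl] at h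
    exact (congrArg G.functor.obj (Expr.value_source E).symm).trans h
  refine PhyDuo.Hom.ext (Functor.hext hobj fun E F (g : Expr.Map E F) => ?_)
  -- Likewise `g` is the value at singletons of `formal g`, the formula from which `freeMap` is
  -- computed.
  refine HEq.trans ?_ (Expr.freeMap_heq_formal V f g).symm
  have h := G.map_evalMap (fun b => Expr.atom (E.term.encode.label b)) (Expr.formal g)
  exact (PhyDuo.map_heq G.functor (Expr.value_source E).symm (Expr.value_target g).symm
    (Expr.valueMap_formal g).symm).trans (h.trans (V.str.evalMap_congr (hρ E) _))

theorem existsUnique_hom (A : Type u) (V : PhyDuo.{v, u}) (f : A → V.carrier) :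
    ∃! F : zetless.{v, u} A ⟶ V, ∀ a : A, F.functor.obj (Expr.atom a) = f a :=
  ⟨freeHom V f, fun _ => rfl, fun G hG => eq_freeHom V f G hG⟩

/-- The adjunction between taking categories of zetless maps and taking sets of objects. -/
noncomputable def zetlessAdjunction : Zetless.{v, u} ⊣ PhyDuo.Obj.{v, u} :=
  Adjunction.mkOfHomEquiv
    { homEquiv := fun _ V =>
        { toFun := fun F => TypeCat.ofHom fun a => F.functor.obj (Expr.atom a)
          invFun := fun f => freeHom V fun a => f a
          left_inv := fun F => (eq_freeHom V _ F fun _ => rfl).symm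
          right_inv := fun _ => rfl }
      homEquiv_naturality_left_symm := fun {_ _ V} φ f =>
        -- Relabelling followed by the extension of `f` agrees on singletons with the extension of
        -- `f` precomposed with `φ`, so uniqueness gives naturality.
        (eq_freeHom V _ ((zetlessMap fun a => φ a).comp (freeHom V fun a => f a)) fun _ => rfl).symm
      homEquiv_naturality_right := fun _ _ => rfl }

end PhysicalDuoidal

theorem theorem5p7 :
    (∀ (A : Type u) (V : PhyDuo.{v, u}) (f : A → V.carrier),
      ∃! F : zetless.{v, u} A ⟶ V, ∀ a : A, F.functor.obj (Expr.atom a) = f a) ∧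
    ∃ adj : Zetless.{v, u} ⊣ PhyDuo.Obj.{v, u},
      ∀ (A : Type u) (a : A), adj.unit.app A a = Expr.atom a :=
  ⟨existsUnique_hom, zetlessAdjunction, fun _ _ => rfl⟩
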